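/- **Languages.** Consider any of the following five presentations of process algebras: CCS; ABC (CCS with broadcast communication, with negative premises $F\not\xrightarrow{b?}$); ABCd (the same, with discard transitions labelled $b{:}$ instead of negative premises); CCSS (CCS with signals, where "$P$ emits $s$" is a derivable predicate, called an indicator); and CCSS with signal emission encoded as transitions $P\xrightarrow{\bar s}P$. They have sets of agent identifiers $A$ with defining equations $A\stackrel{def}{=}P$, of handshake names $\mathscr C$, broadcast names $\mathscr B$ (empty in CCS and CCSS) and signals $\mathscr S$ (empty in CCS and ABC/ABCd). In ABC and ABCd the right-hand sides of defining equations are guarded (each agent identifier in them lies in the scope of a prefix), and in ABCd every relabelling $f$ is surjective on $\mathscr B$. Actions are $\tau,c,\bar c$ and, where present, $b!,b?,s$; the labels also include $\bar s$ and $b{:}$, which are not actions. Let $Rec=\{b?\mid b\in\mathscr B\}$. **Transitions and paths.** States are the processes built from $0$, $\alpha.P$, $P+Q$, $P|Q$, $P\backslash L$, $P[f]$, $A$ and (with signals) $P\hat{\ }s$. The set $Tr$ of transitions consists of the *derivations* of formulas $P\xrightarrow{\ell}Q$ from the structural operational rules of the language. $Tr^\bullet$ is the set of transitions with a label in $Act\setminus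 Rec$, and $Tr^{s\bullet}$ the set of all derivations of indicators or transitions whose label is neither $b?$ nor $b{:}$. A path is a finite or infinite alternating sequence of states and successive transitions labelled by actions; a finite one ends in a state. **Synchrons.** The arguments are $+_L,+_R,|_L,|_R,\backslash L,[f],A{:},\hat{\ }r$; among these $|_L,|_R,\backslash L,[f]$ are static and the others dynamic. A synchron is a string of arguments followed by a leaf $(\xrightarrow{\alpha}P)$, $(P^{\to s})$ or $(b{:})$; the synchrons $\varsigma(\chi)$ of a derivation $\chi$ are the paths in it from the root to a leaf. Those with leaf $(\xrightarrow{\alpha}P)$ are active, and $a\varsigma(\chi)$ is the set of active synchrons of $\chi$. If $\chi$ is labelled $b!$ for some $b$, the set $n\varsigma(\chi)$ of necessary synchrons consists of the synchron of $\chi$ whose leaf performs a broadcast $b'!$; otherwise $n\varsigma(\chi)=\varsigma(\chi)$. Let $static(\sigma)$ be $\sigma$ with all dynamic arguments removed. For synchrons, $\varsigma\leadsto\varsigma'$ means that $\varsigma'=\varsigma$, or $\varsigma=\sigma_1|_D\varsigma_2$ and $\varsigma'=static(\sigma_1)|_D\varsigma_2$ for some $\sigma_1$, $\varsigma_2$ and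 $D\in\{L,R\}$; $\varsigma\smile_d\upsilon$ means that $\varsigma=\sigma_1|_D\varsigma_2$ and $\upsilon=\sigma_1|_E\upsilon_2$ with $\{D,E\}=\{L,R\}$; and $\varsigma'\smile\upsilon'$ means that there are $\varsigma\smile_d\upsilon$ with $\varsigma\leadsto\varsigma'$ and $\upsilon\leadsto\upsilon'$. The relations $\leadsto,\smile_d,\smile$ are defined in the same way on components, i.e. strings of arguments that are empty or end in a static argument. **Concurrency relations.** Let $c(\varsigma)$ be the largest prefix of $\varsigma$ consisting of static arguments, and $c'(\varsigma)$ the result of deleting the arguments $\backslash L$ and $[f]$ from $c(\varsigma)$. Put $npc(\chi)=c(n\varsigma(\chi))$, $afc(\chi)=c(a\varsigma(\chi))$, $npc'(\chi)=c'(n\varsigma(\chi))$ and $afc'(\chi)=c'(a\varsigma(\chi))$. For $\chi\in Tr^{s\bullet}$ and $\zeta\in Tr$ define: * $\chi\smile^\bullet\zeta$ iff $\varsigma\smile\upsilon$ for all $\varsigma\in n\varsigma(\chi)$ and $\upsilon\in a\varsigma(\zeta)$; * $\chi\smile^\bullet_s\zeta$ iff $\gamma\smile\delta$ for all $\gamma\in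 npc(\chi)$ and $\delta\in afc(\zeta)$; * $\chi\smile^\bullet_c\zeta$ iff $npc(\chi)\cap afc(\zeta)=\emptyset$; * $\smile'^\bullet_s$ and $\smile'^\bullet_c$ are defined like $\smile^\bullet_s$ and $\smile^\bullet_c$, but with $npc'$ and $afc'$. **Justness.** Let $Rec\subseteq B\subseteq Act$. For such a relation $\smile_x$, a path $\pi$ is $\smile_x$-$B$-just if for each suffix $\pi'$ of $\pi$ and each $t\in Tr^\bullet$ with $\ell(t)\notin B$ whose source is the starting state of $\pi'$, a transition $u$ with $t\not\smile_x u$ occurs in $\pi'$. **Theorem.** For every instance of each of these languages: 1. for all $B$ with $Rec\subseteq B\subseteq Act$, a path is $\smile^\bullet$-$B$-just if and only if it is $\smile^\bullet_s$-$B$-just, and likewise each of $\smile^\bullet_c$-, $\smile'^\bullet_s$- and $\smile'^\bullet_c$-$B$-justness is equivalent to $\smile^\bullet_s$-$B$-justness, so that all five relations yield the same justness; 2. $\smile^\bullet_s$ is strictly smaller than $\smile^\bullet$: $\chi\smile^\bullet_s\zeta$ implies $\chi\smile^\bullet\zeta$ for all $\chi\in Tr^{s\bullet}$ and $\zeta\in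 Tr$, and there are $t\in Tr^\bullet$ and $u\in Tr$ with $t\smile^\bullet u$ but not $t\smile^\bullet_s u$. -/

import Mathlib

namespace Justness

universe u v w x y

/-! ## Labelled transition systems, paths and justness -/

/-- A labelled transition system over a structured set of labels `Rec ⊆ Act ⊆ Lab`. -/
structure LTS where
  S : Type u
  Tr : Type v
  Lab : Type w
  source : Tr → S
  target : Tr → S
  label : Tr → Lab
  Act : Set Lab
  Rec : Set Lab
  rec_subset : Rec ⊆ Act

/-- The set `Tr•` of transitions that are neither indicator transitions nor receptive. -/
def LTS.TrBullet (T : LTS.{u, v, w}) : Set T.Tr :=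
  {t | T.label t ∈ T.Act \ T.Rec}

/-- The set `Tr•¬B` of non-blocking transitions. -/
def LTS.NonBlocking (T : LTS.{u, v, w}) (B : Set T.Lab) : Set T.Tr :=
  {t | t ∈ T.TrBullet ∧ T.label t ∉ B}

/-- A path: an alternating sequence `s₀ t₀ s₁ t₁ s₂ ⋯` of states and non-indicator transitions,
either infinite (`length = ⊤`) or ending in the state with index `length`. -/
structure LTS.Path (T : LTS.{u, v, w}) where
  length : ℕ∞
  state : ∀ i : ℕ, (i : ℕ∞) ≤ length → T.S
  trans : ∀ i : ℕ, (i : ℕ∞) < length → T.Tr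
  trans_act : ∀ i h, T.label (trans i h) ∈ T.Act
  source_eq : ∀ i h h', T.source (trans i h) = state i h'
  target_eq : ∀ i h h', T.target (trans i h) = state (i + 1) h'

/-- `B`-justness of a path with respect to a relation `conc`, where `conc t u` reads
"`t` is unaffected by `u`".  The suffixes of a path are given by the index `k` of their starting
state; the transitions occurring in such a suffix are those with an index `j ≥ k`. -/
def LTS.Path.IsJust {T : LTS.{u, v, w}} (conc : T.Tr → T.Tr → Prop) (B : Set T.Lab)
    (π : T.Path) : Prop :=
  ∀ (k : ℕ) (hk : (k : ℕ∞) ≤ π.length) (t : T.Tr),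
    t ∈ T.NonBlocking B → T.source t = π.state k hk →
      ∃ (j : ℕ) (hj : (j : ℕ∞) < π.length), k ≤ j ∧ ¬ conc t (π.trans j hj)

/-! ## The languages -/

/-- The five process algebras: CCS, ABC (broadcast, with negative premises), ABCd (broadcast,
with discard transitions), CCSS (signals, emission as a predicate) and CCSSt (signals, emission
encoded as a transition). -/
inductive Dialect
  | ccs
  | abc
  | abcd
  | ccss
  | ccsst

/-- The dialects with broadcast communication. -/
def Dialect.HasBroadcast (d : Dialect) : Prop := d = .abc ∨ d = .abcd

/-- The dialects with signals. -/
def Dialect.HasSignals (d : Dialect) : Prop := d = .ccss ∨ d = .ccsst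

/-- Actions over handshake names `Ch`, broadcast names `Bn` and signals `Sg`:
`τ`, `c`, `c̄`, `b!`, `b?` and `s`. -/
inductive Act (Ch : Type u) (Bn : Type v) (Sg : Type w)
  | tau
  | name (c : Ch)
  | coname (c : Ch)
  | bcast (b : Bn)
  | recv (b : Bn)
  | sig (s : Sg)

/-- Transition labels: actions, signal emissions `s̄` and broadcast discards `b:`. -/
inductive Label (Ch : Type u) (Bn : Type v) (Sg : Type w)
  | act (α : Act Ch Bn Sg)
  | emission (s : Sg)
  | discard (b : Bn)

/-- A relabelling acts on handshake names, broadcast names and signals. -/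
structure Relabelling (Ch : Type u) (Bn : Type v) (Sg : Type w) where
  ch : Ch → Ch
  bn : Bn → Bn
  sg : Sg → Sg

section Labels

variable {Ch : Type u} {Bn : Type v} {Sg : Type w}

def Relabelling.onAct (f : Relabelling Ch Bn Sg) : Act Ch Bn Sg → Act Ch Bn Sg
  | .tau => .tau
  | .name c => .name (f.ch c)
  | .coname c => .coname (f.ch c)
  | .bcast b => .bcast (f.bn b)
  | .recv b => .recv (f.bn b)
  | .sig s => .sig (f.sg s)

def Relabelling.onLabel (f : Relabelling Ch Bn Sg) : Label Ch Bn Sg → Label Ch Bn Sg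
  | .act α => .act (f.onAct α)
  | .emission s => .emission (f.sg s)
  | .discard b => .discard (f.bn b)

/-- In the presentation with discard transitions, relabellings must be surjective on broadcast
names; otherwise some `P[f]` would have neither a `b?`- nor a `b:`-transition, and would block
broadcasts.  In the other dialects every relabelling is admissible. -/
def Relabelling.Admissible (d : Dialect) (f : Relabelling Ch Bn Sg) : Prop :=
  d = .abcd → Function.Surjective f.bn

/-- `Compl c c'` says that `c' = c̄`, for `c` a name, a co-name, a signal or a signal emission. -/
inductive Compl : Label Ch Bn Sg → Label Ch Bn Sg → Prop
  | name (c : Ch) : Compl (.act (.name c)) (.act (.coname c))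
  | coname (c : Ch) : Compl (.act (.coname c)) (.act (.name c))
  | sig (s : Sg) : Compl (.act (.sig s)) (.emission s)
  | emission (s : Sg) : Compl (.emission s) (.act (.sig s))

/-- `ℓ.Restricted L` says that `ℓ ∈ L ∪ L̄`. -/
def Label.Restricted (L : Set (Ch ⊕ Sg)) : Label Ch Bn Sg → Prop
  | .act (.name c) => Sum.inl c ∈ L
  | .act (.coname c) => Sum.inl c ∈ L
  | .act (.sig s) => Sum.inr s ∈ L
  | .emission s => Sum.inr s ∈ L
  | _ => False

/-- The decorations `!`, `?` and `:` of broadcast names. -/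
inductive Mode
  | bang
  | query
  | colon

/-- The label `b!`, `b?` or `b:`. -/
def Mode.label : Mode → Bn → Label Ch Bn Sg
  | .bang, b => .act (.bcast b)
  | .query, b => .act (.recv b)
  | .colon, b => .discard b

/-- The partial composition `♯₁ ∘ ♯₂` of the broadcast rule, undefined only for `! ∘ !`. -/
def Mode.comp : Mode → Mode → Option Mode
  | .bang, .bang => none
  | .bang, _ => some .bang
  | _, .bang => some .bang
  | .query, _ => some .query
  | _, .query => some .query
  | .colon, .colon => some .colon

/-- The labels to which the interleaving rules for parallel composition apply. -/
def Label.NonBroadcast (η : Label Ch Bn Sg) : Prop :=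
  ∀ (m : Mode) (b : Bn), η ≠ m.label b

end Labels

/-- Process expressions over agent identifiers `A`. -/
inductive Proc (d : Dialect) (A : Type u) (Ch : Type v) (Bn : Type w) (Sg : Type x)
  | nil
  | pre (α : Act Ch Bn Sg) (P : Proc d A Ch Bn Sg)
  | sum (P Q : Proc d A Ch Bn Sg)
  | par (P Q : Proc d A Ch Bn Sg)
  | res (P : Proc d A Ch Bn Sg) (L : Set (Ch ⊕ Sg))
  | rel (P : Proc d A Ch Bn Sg) (f : Relabelling Ch Bn Sg) (hf : f.Admissible d)
  | agent (a : A)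
  | signal (P : Proc d A Ch Bn Sg) (s : Sg)

section Semantics

variable {d : Dialect} {A : Type u} {Ch : Type v} {Bn : Type w} {Sg : Type x}

/-- Each agent identifier occurs within the scope of a prefixing operator. -/
def Proc.Guarded : Proc d A Ch Bn Sg → Prop
  | .nil => True
  | .pre _ _ => True
  | .sum P Q => P.Guarded ∧ Q.Guarded
  | .par P Q => P.Guarded ∧ Q.Guarded
  | .res P _ => P.Guarded
  | .rel P _ _ => P.Guarded
  | .agent _ => False
  | .signal P _ => P.Guarded

/-- An instance of one of the languages: the defining equations of the agent identifiers, which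
have guarded right-hand sides in the languages with broadcast.  Languages without broadcast
(signals) have no broadcast names (signals). -/
structure Spec (d : Dialect) (A : Type u) (Ch : Type v) (Bn : Type w) (Sg : Type x) where
  defn : A → Proc d A Ch Bn Sg
  guarded : d.HasBroadcast → ∀ a, (defn a).Guarded
  noBroadcast : ¬ d.HasBroadcast → IsEmpty Bn
  noSignals : ¬ d.HasSignals → IsEmpty Sg

/-- `Receives D b P`: in the language ABC the process `P` admits a `b?`-transition. This predicate
interprets the negative premises of ABC; `receives_iff` below shows that it indeed holds exactly
when a derivation of some `P -b?→ Q` exists. -/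
inductive Receives (D : Spec d A Ch Bn Sg) : Bn → Proc d A Ch Bn Sg → Prop
  | pre (b : Bn) (P) : Receives D b (.pre (.recv b) P)
  | sumL {b P Q} : Receives D b P → Receives D b (.sum P Q)
  | sumR {b P Q} : Receives D b Q → Receives D b (.sum P Q)
  | parL {b P Q} : Receives D b P → Receives D b (.par P Q)
  | parR {b P Q} : Receives D b Q → Receives D b (.par P Q)
  | res {b P L} : Receives D b P → Receives D b (.res P L)
  | rel {b b' P f hf} : Receives D b P → f.bn b = b' → Receives D b' (.rel P f hf)
  | agent {b a} : Receives D b (D.defn a) → Receives D b (.agent a)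

/-- Formulas: transitions `P -ℓ→ Q`, and indicators saying that `P` emits the signal `s`. -/
inductive Formula (d : Dialect) (A : Type u) (Ch : Type v) (Bn : Type w) (Sg : Type x)
  | trans (P : Proc d A Ch Bn Sg) (ℓ : Label Ch Bn Sg) (Q : Proc d A Ch Bn Sg)
  | emits (P : Proc d A Ch Bn Sg) (s : Sg)

open Formula in
/-- Derivations of formulas by the structural operational rules.  Rules that are specific to a
dialect carry a dialect condition, unless their premises or the sets of names make them
inapplicable in the other dialects. -/
inductive Der (D : Spec d A Ch Bn Sg) : Formula d A Ch Bn Sg → Type (max u v w x)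
  -- the rules of CCS
  | act (α P) : Der D (trans (.pre α P) (.act α) P)
  | sumL {P α P'} (χ : Der D (trans P (.act α) P')) (Q) : Der D (trans (.sum P Q) (.act α) P')
  | sumR {Q α Q'} (P) (χ : Der D (trans Q (.act α) Q')) : Der D (trans (.sum P Q) (.act α) Q')
  | parL {P η P'} (χ : Der D (trans P η P')) (Q) (hη : η.NonBroadcast) :
      Der D (trans (.par P Q) η (.par P' Q))
  | comm {P c P' Q c' Q'} (χ : Der D (trans P c P')) (ζ : Der D (trans Q c' Q'))
      (hc : Compl c c') : Der D (trans (.par P Q) (.act .tau) (.par P' Q'))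
  | parR {Q η Q'} (P) (ζ : Der D (trans Q η Q')) (hη : η.NonBroadcast) :
      Der D (trans (.par P Q) η (.par P Q'))
  | res {P ℓ P'} (χ : Der D (trans P ℓ P')) (L) (hℓ : ¬ ℓ.Restricted L) :
      Der D (trans (.res P L) ℓ (.res P' L))
  | rel {P ℓ P' ℓ'} (χ : Der D (trans P ℓ P')) (f hf) (hℓ : ℓ' = f.onLabel ℓ) :
      Der D (trans (.rel P f hf) ℓ' (.rel P' f hf))
  | agent {α P'} (a) (χ : Der D (trans (D.defn a) (.act α) P')) :
      Der D (trans (.agent a) (.act α) P')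
  -- broadcast: the rule for a joint broadcast or receipt (or discard, in ABCd)
  | broC {E E' F F' ℓ} (b : Bn) (m₁ m₂ m : Mode) (χ : Der D (trans E (m₁.label b) E'))
      (ζ : Der D (trans F (m₂.label b) F')) (hm : m₁.comp m₂ = some m) (hℓ : ℓ = m.label b) :
      Der D (trans (.par E F) ℓ (.par E' F'))
  -- broadcast in ABC: the rules with a negative premise
  | broL {E E' ℓ} (hd : d = .abc) (b : Bn) (m : Mode) (χ : Der D (trans E ℓ E')) (F)
      (hF : ¬ Receives D b F) (hℓ : ℓ = m.label b) : Der D (trans (.par E F) ℓ (.par E' F))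
  | broR {F F' ℓ} (hd : d = .abc) (b : Bn) (m : Mode) (E) (hE : ¬ Receives D b E)
      (ζ : Der D (trans F ℓ F')) (hℓ : ℓ = m.label b) : Der D (trans (.par E F) ℓ (.par E F'))
  -- broadcast in ABCd: discards
  | disNil (hd : d = .abcd) (b : Bn) : Der D (trans .nil (.discard b) .nil)
  | disPre (hd : d = .abcd) (b : Bn) (α P) (hα : α ≠ .recv b) :
      Der D (trans (.pre α P) (.discard b) (.pre α P))
  | disSum {E E' F F' b} (χ : Der D (trans E (.discard b) E')) (ζ : Der D (trans F (.discard b) F')) :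
      Der D (trans (.sum E F) (.discard b) (.sum E' F'))
  | disAgent {b P'} (a) (χ : Der D (trans (D.defn a) (.discard b) P')) :
      Der D (trans (.agent a) (.discard b) (.agent a))
  -- signals: an action of the signalling process
  | sigAct {P α P'} (χ : Der D (trans P (.act α) P')) (r) :
      Der D (trans (.signal P r) (.act α) P')
  -- signals in CCSS: emission as a predicate
  | emit (hd : d = .ccss) (P s) : Der D (emits (.signal P s) s)
  | emitSumL {P s} (ξ : Der D (emits P s)) (Q) : Der D (emits (.sum P Q) s)
  | emitSumR {Q s} (P) (ξ : Der D (emits Q s)) : Der D (emits (.sum P Q) s)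
  | emitParL {P s} (ξ : Der D (emits P s)) (Q) : Der D (emits (.par P Q) s)
  | readR {P s Q Q'} (ξ : Der D (emits P s)) (χ : Der D (trans Q (.act (.sig s)) Q')) :
      Der D (trans (.par P Q) (.act .tau) (.par P Q'))
  | readL {P s P' Q} (χ : Der D (trans P (.act (.sig s)) P')) (ξ : Der D (emits Q s)) :
      Der D (trans (.par P Q) (.act .tau) (.par P' Q))
  | emitParR {Q s} (P) (ξ : Der D (emits Q s)) : Der D (emits (.par P Q) s)
  | emitSig {P s} (ξ : Der D (emits P s)) (r) : Der D (emits (.signal P r) s)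
  | emitRes {P s} (ξ : Der D (emits P s)) (L : Set (Ch ⊕ Sg)) (hs : Sum.inr s ∉ L) :
      Der D (emits (.res P L) s)
  | emitRel {P s s'} (ξ : Der D (emits P s)) (f hf) (hs : s' = f.sg s) :
      Der D (emits (.rel P f hf) s')
  | emitAgent {s} (a) (ξ : Der D (emits (D.defn a) s)) : Der D (emits (.agent a) s)
  -- signals in CCSSt: emission as a transition
  | emt (hd : d = .ccsst) (P s) : Der D (trans (.signal P s) (.emission s) (.signal P s))
  | emtSumL {P s P'} (χ : Der D (trans P (.emission s) P')) (Q) :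
      Der D (trans (.sum P Q) (.emission s) (.sum P' Q))
  | emtSumR {Q s Q'} (P) (χ : Der D (trans Q (.emission s) Q')) :
      Der D (trans (.sum P Q) (.emission s) (.sum P Q'))
  | emtSig {P s P'} (χ : Der D (trans P (.emission s) P')) (r) :
      Der D (trans (.signal P r) (.emission s) (.signal P' r))
  | emtAgent {s P'} (a) (χ : Der D (trans (D.defn a) (.emission s) P')) :
      Der D (trans (.agent a) (.emission s) (.agent a))

theorem receives_of_der (D : Spec d A Ch Bn Sg) (hd : d = .abc) {φ : Formula d A Ch Bn Sg}
    (χ : Der D φ) : ∀ P b Q, φ = .trans P (.act (.recv b)) Q → Receives D b P := by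
  have hS : IsEmpty Sg := D.noSignals (by subst hd; simp [Dialect.HasSignals])
  induction χ with
  | act α P =>
    intro P b Q h
    cases h
    exact .pre _ _
  | sumL χ Q ih =>
    intro P b Q h
    cases h
    exact .sumL (ih _ _ _ rfl)
  | sumR P χ ih =>
    intro P b Q h
    cases h
    exact .sumR (ih _ _ _ rfl)
  | parL χ Q hη ih =>
    intro P b Q h
    cases h
    exact absurd rfl (hη .query b)
  | parR P χ hη ih =>
    intro P b Q h
    cases h
    exact absurd rfl (hη .query b)
  | res χ L hℓ ih =>
    intro P b Q h
    cases h
    exact .res (ih _ _ _ rfl)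
  | @rel P ℓ P' ℓ' χ f hf hℓ ih =>
    intro P b Q h
    cases h
    rcases ℓ with α | s | b'
    · cases α <;> simp only [Relabelling.onLabel, Relabelling.onAct, Label.act.injEq, Act.recv.injEq,
        reduceCtorEq] at hℓ
      exact .rel (ih _ _ _ rfl) hℓ.symm
    · simp [Relabelling.onLabel] at hℓ
    · simp [Relabelling.onLabel] at hℓ
  | agent a χ ih =>
    intro P b Q h
    cases h
    exact .agent (ih _ _ _ rfl)
  | broC b m₁ m₂ m χ ζ hm hℓ ih₁ ih₂ =>
    intro P b Q h
    cases h
    cases m <;> simp only [Mode.label, Label.act.injEq, Act.recv.injEq, reduceCtorEq] at hℓ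
    subst hℓ
    cases m₁
    · cases m₂ <;> simp [Mode.comp] at hm
    · exact .parL (ih₁ _ _ _ rfl)
    · cases m₂
      · simp [Mode.comp] at hm
      · exact .parR (ih₂ _ _ _ rfl)
      · simp [Mode.comp] at hm
  | broL hd b m χ F hF hℓ ih =>
    intro P b Q h
    cases h
    cases m <;> cases hℓ
    exact .parL (ih _ _ _ rfl)
  | broR hd b m E hE ζ hℓ ih =>
    intro P b Q h
    cases h
    cases m <;> cases hℓ
    exact .parR (ih _ _ _ rfl)
  | sigAct χ r ih => exact hS.elim r
  | _ =>
    intro P b Q h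
    cases h

theorem der_of_receives_aux (D : Spec d A Ch Bn Sg) (hd : d = .abc) (P : Proc d A Ch Bn Sg)
    (hP : P.Guarded ∨ ∀ a b, Receives D b (D.defn a) →
      ∃ Q, Nonempty (Der D (.trans (D.defn a) (.act (.recv b)) Q))) :
    ∀ b, Receives D b P → ∃ Q, Nonempty (Der D (.trans P (.act (.recv b)) Q)) := by
  have hS : IsEmpty Sg := D.noSignals (by subst hd; simp [Dialect.HasSignals])
  induction P with
  | nil => intro b h; cases h
  | pre α P => intro b h; cases h; exact ⟨_, ⟨.act _ _⟩⟩
  | sum P Q ihP ihQ =>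
    intro b h
    cases h with
    | sumL h =>
      obtain ⟨R, ⟨χ⟩⟩ := ihP (hP.imp_left (·.1)) b h
      exact ⟨_, ⟨.sumL χ _⟩⟩
    | sumR h =>
      obtain ⟨R, ⟨χ⟩⟩ := ihQ (hP.imp_left (·.2)) b h
      exact ⟨_, ⟨.sumR _ χ⟩⟩
  | par P Q ihP ihQ =>
    intro b h
    by_cases h₁ : Receives D b P
    · obtain ⟨R, ⟨χ⟩⟩ := ihP (hP.imp_left (·.1)) b h₁
      by_cases h₂ : Receives D b Q
      · obtain ⟨R', ⟨ζ⟩⟩ := ihQ (hP.imp_left (·.2)) b h₂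
        exact ⟨_, ⟨.broC b .query .query .query χ ζ rfl rfl⟩⟩
      · exact ⟨_, ⟨.broL hd b .query χ Q h₂ rfl⟩⟩
    · have h₂ : Receives D b Q := by
        cases h with
        | parL h => exact absurd h h₁
        | parR h => exact h
      obtain ⟨R', ⟨ζ⟩⟩ := ihQ (hP.imp_left (·.2)) b h₂
      exact ⟨_, ⟨.broR hd b .query P h₁ ζ rfl⟩⟩
  | res P L ih =>
    intro b h
    cases h with
    | res h =>
      obtain ⟨R, ⟨χ⟩⟩ := ih hP b h
      exact ⟨_, ⟨.res χ L (by simp [Label.Restricted])⟩⟩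
  | rel P f hf ih =>
    intro b h
    cases h with
    | rel h hb =>
      obtain ⟨R, ⟨χ⟩⟩ := ih hP _ h
      exact ⟨_, ⟨.rel χ f hf (by subst hb; rfl)⟩⟩
  | agent a =>
    intro b h
    cases h with
    | agent h =>
      obtain ⟨R, ⟨χ⟩⟩ := (hP.resolve_left (fun h' => h')) a b h
      exact ⟨_, ⟨.agent a χ⟩⟩
  | signal P s ih => exact hS.elim s

/-- In ABC, `Receives D b P` says exactly that `P -b?→ Q` is derivable for some `Q`, so that the
negative premises of ABC have their literal meaning. -/
theorem receives_iff (D : Spec d A Ch Bn Sg) (hd : d = .abc) (b : Bn) (P : Proc d A Ch Bn Sg) :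
    Receives D b P ↔ ∃ Q, Nonempty (Der D (.trans P (.act (.recv b)) Q)) := by
  constructor
  · refine der_of_receives_aux D hd P (Or.inr fun a b' h => ?_) b
    exact der_of_receives_aux D hd _ (Or.inl (D.guarded (Or.inl hd) a)) b' h
  · rintro ⟨Q, ⟨χ⟩⟩
    exact receives_of_der D hd χ _ _ _ rfl

/-! ## Synchrons -/

/-- The arguments `+_L, +_R, |_L, |_R, \L, [f], A:, ^r`. -/
inductive Arg (A : Type u) (Ch : Type v) (Bn : Type w) (Sg : Type x)
  | sumL
  | sumR
  | parL
  | parR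
  | res (L : Set (Ch ⊕ Sg))
  | rel (f : Relabelling Ch Bn Sg)
  | agent (a : A)
  | signal (r : Sg)

/-- Static arguments; the other ones are dynamic. -/
def Arg.isStatic : Arg A Ch Bn Sg → Bool
  | .parL => true
  | .parR => true
  | .res _ => true
  | .rel _ => true
  | _ => false

def Arg.isPar : Arg A Ch Bn Sg → Bool
  | .parL => true
  | .parR => true
  | _ => false

/-- `|_D` and `|_E` with `{D, E} = {L, R}`. -/
def Arg.Opposite (p q : Arg A Ch Bn Sg) : Prop :=
  (p = .parL ∧ q = .parR) ∨ (p = .parR ∧ q = .parL)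

/-- The result of removing all dynamic arguments from a string of arguments. -/
def staticPart (σ : List (Arg A Ch Bn Sg)) : List (Arg A Ch Bn Sg) :=
  σ.filter Arg.isStatic

/-- The ends of synchrons: the execution of a prefix `α.P`, the emission of `s` by `P^s`,
or a discard of `b`. -/
inductive Leaf (d : Dialect) (A : Type u) (Ch : Type v) (Bn : Type w) (Sg : Type x)
  | act (α : Act Ch Bn Sg) (P : Proc d A Ch Bn Sg)
  | emit (P : Proc d A Ch Bn Sg) (s : Sg)
  | disc (b : Bn)

/-- A synchron: a string of arguments followed by a leaf. -/
structure Synchron (d : Dialect) (A : Type u) (Ch : Type v) (Bn : Type w) (Sg : Type x) where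
  args : List (Arg A Ch Bn Sg)
  leaf : Leaf d A Ch Bn Sg

/-- `s.under σ` is the synchron `σ s`. -/
def Synchron.under (s : Synchron d A Ch Bn Sg) (σ : List (Arg A Ch Bn Sg)) :
    Synchron d A Ch Bn Sg :=
  ⟨σ ++ s.args, s.leaf⟩

/-- Componentwise application of an argument to a set of synchrons. -/
def Arg.app (ι : Arg A Ch Bn Sg) (X : Set (Synchron d A Ch Bn Sg)) :
    Set (Synchron d A Ch Bn Sg) :=
  (fun s => s.under [ι]) '' X

/-- The set of synchrons of a derivation. -/
def Der.synchrons {D : Spec d A Ch Bn Sg} {φ : Formula d A Ch Bn Sg} :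
    Der D φ → Set (Synchron d A Ch Bn Sg)
  | .act α P => {⟨[], .act α P⟩}
  | .sumL χ _ => Arg.sumL.app χ.synchrons
  | .sumR _ χ => Arg.sumR.app χ.synchrons
  | .parL χ _ _ => Arg.parL.app χ.synchrons
  | .comm χ ζ _ => Arg.parL.app χ.synchrons ∪ Arg.parR.app ζ.synchrons
  | .parR _ ζ _ => Arg.parR.app ζ.synchrons
  | .res χ L _ => (Arg.res L).app χ.synchrons
  | .rel χ f _ _ => (Arg.rel f).app χ.synchrons
  | .agent a χ => (Arg.agent a).app χ.synchrons
  | .broC _ _ _ _ χ ζ _ _ => Arg.parL.app χ.synchrons ∪ Arg.parR.app ζ.synchrons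
  | .broL _ _ _ χ _ _ _ => Arg.parL.app χ.synchrons
  | .broR _ _ _ _ _ ζ _ => Arg.parR.app ζ.synchrons
  | .disNil _ b => {⟨[], .disc b⟩}
  | .disPre _ b _ _ _ => {⟨[], .disc b⟩}
  | .disSum χ ζ => Arg.sumL.app χ.synchrons ∪ Arg.sumR.app ζ.synchrons
  | .disAgent a χ => (Arg.agent a).app χ.synchrons
  | .sigAct χ r => (Arg.signal r).app χ.synchrons
  | .emit _ P s => {⟨[], .emit P s⟩}
  | .emitSumL ξ _ => Arg.sumL.app ξ.synchrons
  | .emitSumR _ ξ => Arg.sumR.app ξ.synchrons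
  | .emitParL ξ _ => Arg.parL.app ξ.synchrons
  | .readR ξ χ => Arg.parL.app ξ.synchrons ∪ Arg.parR.app χ.synchrons
  | .readL χ ξ => Arg.parL.app χ.synchrons ∪ Arg.parR.app ξ.synchrons
  | .emitParR _ ξ => Arg.parR.app ξ.synchrons
  | .emitSig ξ r => (Arg.signal r).app ξ.synchrons
  | .emitRes ξ L _ => (Arg.res L).app ξ.synchrons
  | .emitRel ξ f _ _ => (Arg.rel f).app ξ.synchrons
  | .emitAgent a ξ => (Arg.agent a).app ξ.synchrons
  | .emt _ P s => {⟨[], .emit P s⟩}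
  | .emtSumL χ _ => Arg.sumL.app χ.synchrons
  | .emtSumR _ χ => Arg.sumR.app χ.synchrons
  | .emtSig χ r => (Arg.signal r).app χ.synchrons
  | .emtAgent a χ => (Arg.agent a).app χ.synchrons

/-- `ς.Succ ς'`: the synchron `ς'` is a possible successor of `ς`. -/
def Synchron.Succ (s s' : Synchron d A Ch Bn Sg) : Prop :=
  s' = s ∨ ∃ (σ₁ : List (Arg A Ch Bn Sg)) (p : Arg A Ch Bn Sg) (s₂ : Synchron d A Ch Bn Sg),
    p.isPar ∧ s = s₂.under (σ₁ ++ [p]) ∧ s' = s₂.under (staticPart σ₁ ++ [p])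

/-- Direct concurrency of synchrons. -/
def Synchron.DirConc (s t : Synchron d A Ch Bn Sg) : Prop :=
  ∃ (σ₁ : List (Arg A Ch Bn Sg)) (p q : Arg A Ch Bn Sg) (s₂ t₂ : Synchron d A Ch Bn Sg),
    p.Opposite q ∧ s = s₂.under (σ₁ ++ [p]) ∧ t = t₂.under (σ₁ ++ [q])

/-- Concurrency of synchrons. -/
def Synchron.Conc (s' t' : Synchron d A Ch Bn Sg) : Prop :=
  ∃ s t : Synchron d A Ch Bn Sg, s.Succ s' ∧ s.DirConc t ∧ t.Succ t'

/-! ## Components -/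

/-- A component is the empty string or a string of arguments ending in a static argument. -/
def IsComponent (γ : List (Arg A Ch Bn Sg)) : Prop :=
  γ = [] ∨ ∃ (σ : List (Arg A Ch Bn Sg)) (ι : Arg A Ch Bn Sg), ι.isStatic ∧ γ = σ ++ [ι]

/-- `CompSucc γ γ'`: the component `γ'` is a possible successor of the component `γ`. -/
def CompSucc (γ γ' : List (Arg A Ch Bn Sg)) : Prop :=
  γ' = γ ∨ ∃ (σ₁ : List (Arg A Ch Bn Sg)) (p : Arg A Ch Bn Sg) (γ₂ : List (Arg A Ch Bn Sg)),
    p.isPar ∧ IsComponent γ₂ ∧ γ = σ₁ ++ [p] ++ γ₂ ∧ γ' = staticPart σ₁ ++ [p] ++ γ₂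

/-- Direct concurrency of components. -/
def CompDirConc (γ δ : List (Arg A Ch Bn Sg)) : Prop :=
  ∃ (σ₁ : List (Arg A Ch Bn Sg)) (p q : Arg A Ch Bn Sg) (γ₂ δ₂ : List (Arg A Ch Bn Sg)),
    p.Opposite q ∧ γ = σ₁ ++ [p] ++ γ₂ ∧ δ = σ₁ ++ [q] ++ δ₂

/-- Concurrency of components. -/
def CompConc (γ' δ' : List (Arg A Ch Bn Sg)) : Prop :=
  ∃ γ δ : List (Arg A Ch Bn Sg), IsComponent γ ∧ IsComponent δ ∧
    CompSucc γ γ' ∧ CompDirConc γ δ ∧ CompSucc δ δ'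

/-- The static component `c(ς)`: the largest prefix consisting of static arguments. -/
def Synchron.staticComp (s : Synchron d A Ch Bn Sg) : List (Arg A Ch Bn Sg) :=
  s.args.takeWhile Arg.isStatic

/-- The abstract static component `c'(ς)`: `c(ς)` without the arguments `\L` and `[f]`. -/
def Synchron.absComp (s : Synchron d A Ch Bn Sg) : List (Arg A Ch Bn Sg) :=
  s.staticComp.filter Arg.isPar

/-! ## Derivations, transitions and the concurrency relations -/

def Formula.source : Formula d A Ch Bn Sg → Proc d A Ch Bn Sg
  | .trans P _ _ => P
  | .emits P _ => P

/-- The label of a formula; an indicator that `s` is emitted has label `s̄`. -/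
def Formula.label : Formula d A Ch Bn Sg → Label Ch Bn Sg
  | .trans _ ℓ _ => ℓ
  | .emits _ s => .emission s

/-- A derivation of some formula. -/
structure FormulaDeriv (D : Spec d A Ch Bn Sg) where
  formula : Formula d A Ch Bn Sg
  der : Der D formula

/-- An element of `Tr`: a derivation of a transition. -/
structure Transition (D : Spec d A Ch Bn Sg) where
  source : Proc d A Ch Bn Sg
  label : Label Ch Bn Sg
  target : Proc d A Ch Bn Sg
  der : Der D (.trans source label target)

def Transition.toFormulaDeriv {D : Spec d A Ch Bn Sg} (t : Transition D) : FormulaDeriv D :=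
  ⟨.trans t.source t.label t.target, t.der⟩

/-- The set `Tr^{s•}` of derivations of indicators and of transitions that are neither receptive
nor broadcast discards. -/
def FormulaDeriv.InTrSBullet {D : Spec d A Ch Bn Sg} (χ : FormulaDeriv D) : Prop :=
  ∀ b : Bn, χ.formula.label ≠ .act (.recv b) ∧ χ.formula.label ≠ .discard b

namespace FormulaDeriv

variable {D : Spec d A Ch Bn Sg}

/-- The set `ς(χ)` of synchrons of a derivation. -/
def synchrons (χ : FormulaDeriv D) : Set (Synchron d A Ch Bn Sg) :=
  χ.der.synchrons

/-- The set `aς(χ)` of active synchrons. -/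
def activeSyn (χ : FormulaDeriv D) : Set (Synchron d A Ch Bn Sg) :=
  {s | s ∈ χ.synchrons ∧ ∃ α P, s.leaf = .act α P}

/-- The set `nς(χ)` of necessary synchrons: for a broadcast only the synchron that performs it
(whose name may differ from the one in the label of `χ`, due to relabelling), and otherwise all
synchrons. -/
def necessarySyn (χ : FormulaDeriv D) : Set (Synchron d A Ch Bn Sg) :=
  {s | s ∈ χ.synchrons ∧
    ((∃ b, χ.formula.label = .act (.bcast b)) → ∃ b P, s.leaf = .act (.bcast b) P)}

/-- `npc(χ)` and `afc(χ)`: the necessary and the affected static components. -/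
def npc (χ : FormulaDeriv D) : Set (List (Arg A Ch Bn Sg)) :=
  Synchron.staticComp '' χ.necessarySyn

def afc (χ : FormulaDeriv D) : Set (List (Arg A Ch Bn Sg)) :=
  Synchron.staticComp '' χ.activeSyn

/-- `npc'(χ)` and `afc'(χ)`: the necessary and the affected abstract static components. -/
def npcAbs (χ : FormulaDeriv D) : Set (List (Arg A Ch Bn Sg)) :=
  Synchron.absComp '' χ.necessarySyn

def afcAbs (χ : FormulaDeriv D) : Set (List (Arg A Ch Bn Sg)) :=
  Synchron.absComp '' χ.activeSyn

/-- The (dynamic) concurrency relation `χ ⌣• ζ`: `χ` is unaffected by `ζ`. -/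
def Conc (χ ζ : FormulaDeriv D) : Prop :=
  ∀ s ∈ χ.necessarySyn, ∀ t ∈ ζ.activeSyn, s.Conc t

/-- The static concurrency relation `χ ⌣•_s ζ`. -/
def ConcS (χ ζ : FormulaDeriv D) : Prop :=
  ∀ γ ∈ χ.npc, ∀ δ ∈ ζ.afc, CompConc γ δ

/-- The relation `χ ⌣•_c ζ`. -/
def ConcC (χ ζ : FormulaDeriv D) : Prop :=
  χ.npc ∩ ζ.afc = ∅

/-- The relation `χ ⌣•'_s ζ`. -/
def ConcSAbs (χ ζ : FormulaDeriv D) : Prop :=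
  ∀ γ ∈ χ.npcAbs, ∀ δ ∈ ζ.afcAbs, CompConc γ δ

/-- The relation `χ ⌣•'_c ζ`. -/
def ConcCAbs (χ ζ : FormulaDeriv D) : Prop :=
  χ.npcAbs ∩ ζ.afcAbs = ∅

end FormulaDeriv

/-- The labelled transition system of a language instance: the states are the processes, and the
transitions are the derivations of transition formulas.  Receptive are the actions `b?`. -/
def Spec.lts (D : Spec d A Ch Bn Sg) : LTS where
  S := Proc d A Ch Bn Sg
  Tr := Transition D
  Lab := Label Ch Bn Sg
  source := Transition.source
  target := Transition.target
  label := Transition.label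
  Act := {ℓ | ∃ α, ℓ = .act α}
  Rec := {ℓ | ∃ b, ℓ = .act (.recv b)}
  rec_subset := fun _ ⟨b, h⟩ => ⟨.recv b, h⟩

/-- `⌣-B`-justness of a path, for a relation between derivations. -/
def Spec.IsJust (D : Spec d A Ch Bn Sg) (conc : FormulaDeriv D → FormulaDeriv D → Prop)
    (B : Set (Label Ch Bn Sg)) (π : D.lts.Path) : Prop :=
  LTS.Path.IsJust (T := D.lts)
    (fun t u => conc (Transition.toFormulaDeriv t) (Transition.toFormulaDeriv u)) B π

end Semantics

end Justness

open Justness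

/-! Everything is reduced to the argument strings of synchrons. A string is an address in the syntax
tree of a process. Two strings diverge when they separate at a parallel composition. Static
concurrency asks that they do so before any dynamic argument (`compConc_staticPrefix_iff`). A larger
relation makes justness more demanding. `ConcS` is contained in `Conc` and also in the chain
`ConcSAbs`, `ConcCAbs`, `ConcC`. So it remains to derive `ConcC`-justness and `Conc`-justness from
`ConcS`-justness. Two facts carry this. The first is persistence (`Der.persists_of_allDiverge`): if
all necessary strings of `t` diverge from all active strings of a transition `u` with the same
source, then after `u` a transition with the label of `t` is still enabled, and its necessary
strings arise from those of `t` by deleting the dynamic arguments shared with `u` (`strip`). The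
second is a classification of pairs of synchrons of one process (`ArgPath.compatible`). It shows
that for derivations with a common source, concurrent strings really diverge, and that strings with
different static components diverge statically. For `ConcC`: let `t` be `ConcC`-unaffected by
everything that happens on a suffix. By induction along the suffix, `t` keeps a copy with unchanged
necessary strings, the classification applies to this copy, and so `t` is `ConcS`-unaffected
throughout, against `ConcS`-justness. For `Conc`: the same argument works up to the first transition
`u` that is not statically concurrent with `t`. There the residual of `t` loses at least one dynamic
argument, and it is still `Conc`-unaffected by the rest of the path, because its synchrons are
successors of those of `t`. The total length of the necessary strings drops each time, so this
cannot go on forever. -/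

namespace Justness

universe u v w x

/-! ### Strings of arguments: divergence and static divergence. -/

section Lists

variable {A : Type u} {Ch : Type v} {Bn : Type w} {Sg : Type x}

/-- The string-of-arguments version of direct concurrency: `l` and `m` have a common prefix, after
which they proceed to different sides of a parallel composition. -/
def Diverge (l m : List (Arg A Ch Bn Sg)) : Prop :=
  ∃ (σ : List (Arg A Ch Bn Sg)) (p q : Arg A Ch Bn Sg) (x y : List (Arg A Ch Bn Sg)),
    p.Opposite q ∧ l = σ ++ p :: x ∧ m = σ ++ q :: y

/-- Divergence after a common prefix that consists of static arguments. -/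
def StaticDiverge (l m : List (Arg A Ch Bn Sg)) : Prop :=
  ∃ (σ : List (Arg A Ch Bn Sg)) (p q : Arg A Ch Bn Sg) (x y : List (Arg A Ch Bn Sg)),
    (∀ a ∈ σ, a.isStatic) ∧ p.Opposite q ∧ l = σ ++ p :: x ∧ m = σ ++ q :: y

/-- The string-of-arguments version of `Synchron.Succ`. -/
def ArgsSucc (l l' : List (Arg A Ch Bn Sg)) : Prop :=
  l' = l ∨ ∃ (σ : List (Arg A Ch Bn Sg)) (p : Arg A Ch Bn Sg) (x : List (Arg A Ch Bn Sg)),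
    p.isPar ∧ l = σ ++ p :: x ∧ l' = staticPart σ ++ p :: x

/-- The string-of-arguments version of `Synchron.Conc`. -/
def ArgsConc (l' m' : List (Arg A Ch Bn Sg)) : Prop :=
  ∃ l m, ArgsSucc l l' ∧ Diverge l m ∧ ArgsSucc m m'

theorem Arg.Opposite.isPar_left {p q : Arg A Ch Bn Sg} (h : p.Opposite q) : p.isPar := by
  rcases h with ⟨rfl, rfl⟩ | ⟨rfl, rfl⟩ <;> rfl

theorem Arg.Opposite.symm {p q : Arg A Ch Bn Sg} (h : p.Opposite q) : q.Opposite p := by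
  rcases h with ⟨rfl, rfl⟩ | ⟨rfl, rfl⟩ <;> simp [Arg.Opposite]

theorem Arg.Opposite.ne {p q : Arg A Ch Bn Sg} (h : p.Opposite q) : p ≠ q := by
  rcases h with ⟨rfl, rfl⟩ | ⟨rfl, rfl⟩ <;> simp

theorem Arg.isStatic_of_isPar {p : Arg A Ch Bn Sg} (h : p.isPar) : p.isStatic := by
  cases p <;> simp_all [Arg.isPar, Arg.isStatic]

theorem diverge_cons_cons {a : Arg A Ch Bn Sg} {l m : List (Arg A Ch Bn Sg)} :
    Diverge (a :: l) (a :: m) ↔ Diverge l m := by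
  constructor
  · rintro ⟨σ, p, q, x, y, h, h₁, h₂⟩
    cases σ with
    | nil =>
      simp only [List.nil_append, List.cons.injEq] at h₁ h₂
      exact absurd (h₁.1.symm.trans h₂.1) h.ne
    | cons b σ =>
      simp only [List.cons_append, List.cons.injEq] at h₁ h₂
      exact ⟨σ, p, q, x, y, h, h₁.2, h₂.2⟩
  · rintro ⟨σ, p, q, x, y, h, rfl, rfl⟩
    exact ⟨a :: σ, p, q, x, y, h, rfl, rfl⟩

theorem staticDiverge_cons_cons {a : Arg A Ch Bn Sg} {l m : List (Arg A Ch Bn Sg)} :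
    StaticDiverge (a :: l) (a :: m) ↔ a.isStatic ∧ StaticDiverge l m := by
  constructor
  · rintro ⟨σ, p, q, x, y, hσ, h, h₁, h₂⟩
    cases σ with
    | nil =>
      simp only [List.nil_append, List.cons.injEq] at h₁ h₂
      exact absurd (h₁.1.symm.trans h₂.1) h.ne
    | cons b σ =>
      simp only [List.cons_append, List.cons.injEq] at h₁ h₂
      exact ⟨h₁.1 ▸ hσ b (by simp), σ, p, q, x, y, fun c hc => hσ c (by simp [hc]), h, h₁.2, h₂.2⟩
  · rintro ⟨ha, σ, p, q, x, y, hσ, h, rfl, rfl⟩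
    exact ⟨a :: σ, p, q, x, y, by simpa using ⟨ha, hσ⟩, h, rfl, rfl⟩

theorem Diverge.cons_eq {a b : Arg A Ch Bn Sg} {l m : List (Arg A Ch Bn Sg)}
    (h : Diverge (a :: l) (b :: m)) : a.Opposite b ∨ a = b ∧ Diverge l m := by
  obtain ⟨σ, p, q, x, y, h, h₁, h₂⟩ := h
  cases σ with
  | nil =>
    simp only [List.nil_append, List.cons.injEq] at h₁ h₂
    rw [h₁.1, h₂.1]
    exact .inl h
  | cons c σ =>
    simp only [List.cons_append, List.cons.injEq] at h₁ h₂
    exact .inr ⟨h₁.1.trans h₂.1.symm, σ, p, q, x, y, h, h₁.2, h₂.2⟩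

theorem not_diverge_nil_left (m : List (Arg A Ch Bn Sg)) : ¬ Diverge [] m := by
  rintro ⟨σ, p, q, x, y, h, h₁, h₂⟩
  simp at h₁

theorem not_diverge_nil_right (m : List (Arg A Ch Bn Sg)) : ¬ Diverge m [] := by
  rintro ⟨σ, p, q, x, y, h, h₁, h₂⟩
  simp at h₂

/-- Divergence requires two different arguments at the same position. This disposes of equal strings
and of an emission located above an active leaf. -/
theorem not_diverge_append (l m : List (Arg A Ch Bn Sg)) : ¬ Diverge l (l ++ m) := by
  induction l with
  | nil => exact not_diverge_nil_left _
  | cons a l ih => rwa [List.cons_append, diverge_cons_cons]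

theorem StaticDiverge.diverge {l m : List (Arg A Ch Bn Sg)} (h : StaticDiverge l m) :
    Diverge l m := by
  obtain ⟨σ, p, q, x, y, -, h⟩ := h
  exact ⟨σ, p, q, x, y, h⟩

/-! ### Removing dynamic arguments before a point of divergence -/

open Classical in
/-- `strip l V` is obtained from `l` by deleting the dynamic arguments that `l` shares with some
element of `V`. -/
noncomputable def strip : List (Arg A Ch Bn Sg) → Set (List (Arg A Ch Bn Sg)) →
    List (Arg A Ch Bn Sg)
  | [], _ => []
  | a :: l, V =>
    -- In the recursion `V` holds the tails of the elements that share the arguments read so far.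
    -- Once it is empty nothing more is shared, and the rest of the string stays. A dynamic head is
    -- dropped without testing that it is shared, which is harmless when all elements of `V` diverge
    -- from the string: they then all begin with that head.
    if V = ∅ then a :: l
    else if a.isStatic then a :: strip l {m | a :: m ∈ V} else strip l {m | a :: m ∈ V}

@[simp]
theorem strip_empty (l : List (Arg A Ch Bn Sg)) : strip l ∅ = l := by
  cases l <;> simp [strip]

theorem strip_cons_of_isStatic {a : Arg A Ch Bn Sg} (ha : a.isStatic)
    (l : List (Arg A Ch Bn Sg)) (V : Set (List (Arg A Ch Bn Sg))) :
    strip (a :: l) V = a :: strip l {m | a :: m ∈ V} := by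
  by_cases hV : V = ∅
  · simp [hV]
  · simp [strip, hV, ha]

theorem strip_cons_of_not_isStatic {a : Arg A Ch Bn Sg} (ha : ¬ a.isStatic)
    (l : List (Arg A Ch Bn Sg)) {V : Set (List (Arg A Ch Bn Sg))} (hV : V.Nonempty) :
    strip (a :: l) V = strip l {m | a :: m ∈ V} := by
  simp [strip, hV.ne_empty, ha]

theorem length_strip_le (l : List (Arg A Ch Bn Sg)) (V : Set (List (Arg A Ch Bn Sg))) :
    (strip l V).length ≤ l.length := by
  induction l generalizing V with
  | nil => simp [strip]
  | cons a l ih =>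
    have := ih {m | a :: m ∈ V}
    rw [strip]
    split_ifs <;> simp <;> omega

/-- The argument `p` is the deepest point at which some element of `V` leaves `l`; the whole of `l`
before it is shared with that element. Hence stripping against many strings at once is a single
successor step. -/
theorem strip_spec {l : List (Arg A Ch Bn Sg)} {V : Set (List (Arg A Ch Bn Sg))}
    (hV : V.Nonempty) (h : ∀ m ∈ V, Diverge l m) :
    ∃ (σ : List (Arg A Ch Bn Sg)) (p : Arg A Ch Bn Sg) (x : List (Arg A Ch Bn Sg)),
      p.isPar ∧ l = σ ++ p :: x ∧ strip l V = staticPart σ ++ p :: x := by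
  induction l generalizing V with
  | nil =>
    obtain ⟨m, hm⟩ := hV
    exact absurd (h m hm) (not_diverge_nil_left m)
  | cons a l ih =>
    have hW : ∀ m ∈ {m | a :: m ∈ V}, Diverge l m := fun m hm => diverge_cons_cons.1 (h _ hm)
    by_cases ha : a.isStatic
    · rw [strip_cons_of_isStatic ha]
      rcases Set.eq_empty_or_nonempty {m | a :: m ∈ V} with hE | hE
      · obtain ⟨m, hm⟩ := hV
        cases m with
        | nil => exact absurd (h _ hm) (not_diverge_nil_right _)
        | cons b m =>
          rcases (h _ hm).cons_eq with hab | ⟨rfl, -⟩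
          · exact ⟨[], a, l, hab.isPar_left, rfl, by simp [hE, staticPart]⟩
          · exact absurd (show m ∈ {m | a :: m ∈ V} from hm) (by simp [hE])
      · obtain ⟨σ, p, x, hp, hl, hs⟩ := ih hE hW
        exact ⟨a :: σ, p, x, hp, by simp [hl], by simp [hs, staticPart, ha]⟩
    · rw [strip_cons_of_not_isStatic ha _ hV]
      have hE : {m | a :: m ∈ V}.Nonempty := by
        obtain ⟨m, hm⟩ := hV
        cases m with
        | nil => exact absurd (h _ hm) (not_diverge_nil_right _)
        | cons b m =>
          rcases (h _ hm).cons_eq with hab | ⟨rfl, -⟩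
          · exact absurd (Arg.isStatic_of_isPar hab.isPar_left) ha
          · exact ⟨m, hm⟩
      obtain ⟨σ, p, x, hp, hl, hs⟩ := ih hE hW
      exact ⟨a :: σ, p, x, hp, by simp [hl], by simp [hs, staticPart, ha]⟩

theorem argsSucc_strip {l : List (Arg A Ch Bn Sg)} {V : Set (List (Arg A Ch Bn Sg))}
    (h : ∀ m ∈ V, Diverge l m) : ArgsSucc l (strip l V) := by
  rcases V.eq_empty_or_nonempty with rfl | hV
  · exact .inl (strip_empty l)
  · exact .inr (strip_spec hV h)

theorem strip_eq_self {l : List (Arg A Ch Bn Sg)} {V : Set (List (Arg A Ch Bn Sg))}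
    (h : ∀ m ∈ V, StaticDiverge l m) : strip l V = l := by
  induction l generalizing V with
  | nil => rfl
  | cons a l ih =>
    rcases V.eq_empty_or_nonempty with rfl | ⟨m, hm⟩
    · exact strip_empty _
    · have ha : a.isStatic := by
        obtain ⟨σ, p, q, x, y, hσ, ho, h₁, -⟩ := h m hm
        cases σ with
        | nil => cases h₁; exact Arg.isStatic_of_isPar ho.isPar_left
        | cons b σ => cases h₁; exact hσ _ (by simp)
      rw [strip_cons_of_isStatic ha, ih (V := {m | a :: m ∈ V})
        fun m hm => (staticDiverge_cons_cons.1 (h _ hm)).2]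

/-- Every dynamic argument before a point of divergence is deleted and shortens the string.
Unchanged length thus means that only static arguments precede the divergence. This yields the
strict decrease of the measure in `Spec.IsJust.conc_of_concS`. -/
theorem staticDiverge_of_length_strip {l : List (Arg A Ch Bn Sg)}
    {V : Set (List (Arg A Ch Bn Sg))} (h : ∀ m ∈ V, Diverge l m)
    (hl : l.length ≤ (strip l V).length) : ∀ m ∈ V, StaticDiverge l m := by
  induction l generalizing V with
  | nil => exact fun m hm => absurd (h m hm) (not_diverge_nil_left m)
  | cons a l ih =>
    intro m hm
    by_cases ha : a.isStatic
    · rw [strip_cons_of_isStatic ha] at hl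
      cases m with
      | nil => exact absurd (h _ hm) (not_diverge_nil_right _)
      | cons b m =>
        rcases (h _ hm).cons_eq with hab | ⟨rfl, -⟩
        · exact ⟨[], a, b, l, m, by simp, hab, rfl, rfl⟩
        · exact staticDiverge_cons_cons.2 ⟨ha, ih (V := {m | a :: m ∈ V})
            (fun m hm => diverge_cons_cons.1 (h _ hm)) (by simpa using hl) m hm⟩
    · rw [strip_cons_of_not_isStatic ha _ ⟨m, hm⟩] at hl
      have := length_strip_le l {m | a :: m ∈ V}
      simp only [List.length_cons] at hl
      omega

/-! ### Successors -/

theorem staticPart_append (l m : List (Arg A Ch Bn Sg)) :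
    staticPart (l ++ m) = staticPart l ++ staticPart m := by
  simp [staticPart]

theorem staticPart_staticPart (l : List (Arg A Ch Bn Sg)) :
    staticPart (staticPart l) = staticPart l := by
  simp [staticPart]

theorem staticPart_eq_self {l : List (Arg A Ch Bn Sg)} (h : ∀ a ∈ l, a.isStatic) :
    staticPart l = l := by
  simpa [staticPart] using h

theorem isStatic_of_mem_staticPart {l : List (Arg A Ch Bn Sg)} {a : Arg A Ch Bn Sg}
    (h : a ∈ staticPart l) : a.isStatic := by
  simp only [staticPart, List.mem_filter] at h
  exact h.2

theorem ArgsSucc.staticPart_eq {l l' : List (Arg A Ch Bn Sg)} (h : ArgsSucc l l') :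
    staticPart l' = staticPart l := by
  rcases h with rfl | ⟨σ, p, x, -, rfl, rfl⟩
  · rfl
  · simp [staticPart_append, staticPart_staticPart]

/-- Each step removes the dynamic arguments before a chosen parallel argument, so two steps amount
to the one with the deeper choice. -/
theorem ArgsSucc.trans {l m n : List (Arg A Ch Bn Sg)} (h₁ : ArgsSucc l m) (h₂ : ArgsSucc m n) :
    ArgsSucc l n := by
  rcases h₁ with rfl | ⟨σ, p, x, hp, rfl, rfl⟩
  · exact h₂
  rcases h₂ with rfl | ⟨τ, q, y, hq, h, rfl⟩
  · exact .inr ⟨σ, p, x, hp, rfl, rfl⟩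
  -- Either the second cut is at or behind the first one, and then it subsumes the first; or it lies
  -- inside the part that is static already, and then the second step changes nothing.
  rcases List.append_eq_append_iff.1 h with ⟨z, rfl, hz⟩ | ⟨z, hσ, hz⟩
  · cases z with
    | nil =>
      simp only [List.nil_append, List.cons.injEq] at hz
      obtain ⟨rfl, rfl⟩ := hz
      exact .inr ⟨σ, p, x, hp, rfl, by simp [staticPart_staticPart]⟩
    | cons c z =>
      simp only [List.cons_append, List.cons.injEq] at hz
      obtain ⟨rfl, rfl⟩ := hz
      refine .inr ⟨σ ++ p :: z, q, y, hq, by simp, ?_⟩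
      simp [staticPart_append, staticPart_staticPart]
  · refine .inr ⟨σ, p, x, hp, rfl, ?_⟩
    have hs : ∀ a ∈ τ, a.isStatic := fun a ha =>
      isStatic_of_mem_staticPart (l := σ) (by rw [hσ]; simp [ha])
    rw [staticPart_eq_self hs, ← h]

theorem ArgsConc.of_succ {l l' m : List (Arg A Ch Bn Sg)} (h : ArgsConc l m)
    (hl : ArgsSucc l l') : ArgsConc l' m := by
  obtain ⟨l₀, m₀, h₁, h₂, h₃⟩ := h
  exact ⟨l₀, m₀, h₁.trans hl, h₂, h₃⟩

theorem Diverge.staticPart {l m : List (Arg A Ch Bn Sg)} (h : Diverge l m) :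
    Diverge (staticPart l) (Justness.staticPart m) := by
  obtain ⟨σ, p, q, x, y, h, rfl, rfl⟩ := h
  refine ⟨Justness.staticPart σ, p, q, Justness.staticPart x, Justness.staticPart y, h, ?_, ?_⟩
  · simp [Justness.staticPart, Arg.isStatic_of_isPar h.isPar_left]
  · simp [Justness.staticPart, Arg.isStatic_of_isPar h.symm.isPar_left]

/-- Static parts are invariant under successors, and divergence survives the removal of dynamic
arguments because parallel arguments are static. -/
theorem ArgsConc.diverge_staticPart {l m : List (Arg A Ch Bn Sg)} (h : ArgsConc l m) :
    Diverge (staticPart l) (staticPart m) := by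
  obtain ⟨l₀, m₀, h₁, h₂, h₃⟩ := h
  rw [h₁.staticPart_eq, h₃.staticPart_eq]
  exact h₂.staticPart

/-- The number of arguments behind the last parallel composition. -/
def tailLength (l : List (Arg A Ch Bn Sg)) : ℕ :=
  l.foldl (fun n a => if a.isPar then 0 else n + 1) 0

theorem tailLength_append_par (l m : List (Arg A Ch Bn Sg)) {p : Arg A Ch Bn Sg} (hp : p.isPar) :
    tailLength (l ++ p :: m) = tailLength m := by
  simp [tailLength, hp]

theorem tailLength_append_of_staticPart {l m : List (Arg A Ch Bn Sg)} (hm : staticPart m = []) :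
    tailLength (l ++ m) = tailLength l + m.length := by
  simp only [tailLength, List.foldl_append]
  generalize List.foldl _ 0 l = n
  induction m generalizing n with
  | nil => rfl
  | cons a m ih =>
    have ha : ¬ a.isStatic := by
      intro ha
      simp [staticPart, ha] at hm
    have ha' : ¬ a.isPar := fun h => ha (Arg.isStatic_of_isPar h)
    simp only [staticPart, List.filter_cons, ha] at hm
    rw [List.foldl_cons, ih (by simpa [staticPart] using hm)]
    simp only [ha', List.length_cons]
    simp
    omega

/-- A dynamic argument that is still present must lie behind the cut, so `d` and all that follows
were there before. Only arguments in front of a parallel argument inside `ρ` can have been lost;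
this affects neither the static part of `ρ` nor the number of arguments behind its last parallel
argument. -/
theorem ArgsSucc.exists_of_append_dynamic {l₀ ρ x : List (Arg A Ch Bn Sg)} {d : Arg A Ch Bn Sg}
    (hd : ¬ d.isStatic) (h : ArgsSucc l₀ (ρ ++ d :: x)) :
    ∃ ρ₀, l₀ = ρ₀ ++ d :: x ∧ staticPart ρ₀ = staticPart ρ ∧ tailLength ρ₀ = tailLength ρ := by
  rcases h with h | ⟨σ, p, y, hp, rfl, h⟩
  · exact ⟨ρ, h.symm, rfl, rfl⟩
  · rcases List.append_eq_append_iff.1 h with ⟨z, hσ, hz⟩ | ⟨z, rfl, hz⟩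
    · cases z with
      | nil =>
        cases hz
        exact absurd (Arg.isStatic_of_isPar hp) hd
      | cons c z =>
        cases hz
        exact absurd (isStatic_of_mem_staticPart (l := σ) (by rw [hσ]; simp)) hd
    · cases z with
      | nil =>
        cases hz
        exact absurd (Arg.isStatic_of_isPar hp) hd
      | cons c z =>
        cases hz
        refine ⟨σ ++ p :: z, by simp, ?_, ?_⟩
        · simp [staticPart_append, staticPart_staticPart]
        · simp [tailLength_append_par _ _ hp]

theorem length_staticPart_le_of_diverge {τ σ x y x' y' : List (Arg A Ch Bn Sg)}
    {p q : Arg A Ch Bn Sg} (hpq : p ≠ q) (h₁ : τ ++ x = σ ++ p :: x') (h₂ : τ ++ y = σ ++ q :: y') :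
    τ.length ≤ σ.length := by
  by_contra! h
  have e₁ := congrArg (fun l => l[σ.length]?) h₁
  have e₂ := congrArg (fun l => l[σ.length]?) h₂
  simp only [List.getElem?_append_left h, List.getElem?_append_right le_rfl, Nat.sub_self,
    List.getElem?_cons_zero] at e₁ e₂
  exact hpq (Option.some.inj (e₁.symm.trans e₂))

/-- If `σ` stopped short of `d`, then `ρ` would contain all of `σ` together with the static argument
`p`, and so have more static arguments than `σ`. -/
theorem exists_prefix_of_length_staticPart {ρ x σ a : List (Arg A Ch Bn Sg)}
    {d p : Arg A Ch Bn Sg} (hd : ¬ d.isStatic) (hp : p.isStatic) (h : ρ ++ d :: x = σ ++ p :: a)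
    (hl : (staticPart ρ).length ≤ (staticPart σ).length) : ∃ z, σ = ρ ++ d :: z := by
  rcases List.append_eq_append_iff.1 h with ⟨z, rfl, hz⟩ | ⟨z, rfl, hz⟩
  · cases z with
    | nil => cases hz; exact absurd hp hd
    | cons c z => cases hz; exact ⟨z, rfl⟩
  · cases z with
    | nil => cases hz; exact absurd hp hd
    | cons c z =>
      cases hz
      simp [staticPart, hp] at hl

/-- Different branches of a choice are never concurrent, even through predecessors. Diverging
predecessors would have the forms `ρ₁ d x` and `ρ₂ e y`, where `ρ₁` and `ρ₂` have the static part
and the tail length of `ρ`. Counting static arguments puts both `d` and `e` inside the common prefix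
`σ`. If `ρ₁` and `ρ₂` coincide, then `d` equals `e`; otherwise one properly extends the other by
dynamic arguments only, which changes the tail length. -/
theorem not_argsConc_of_dynamic {ρ x y : List (Arg A Ch Bn Sg)} {d e : Arg A Ch Bn Sg}
    (hd : ¬ d.isStatic) (he : ¬ e.isStatic) (hde : d ≠ e) :
    ¬ ArgsConc (ρ ++ d :: x) (ρ ++ e :: y) := by
  rintro ⟨l₀, m₀, h₁, ⟨σ, p, q, a, b, ho, hl, hm⟩, h₂⟩
  obtain ⟨ρ₁, rfl, hs₁, ht₁⟩ := h₁.exists_of_append_dynamic hd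
  obtain ⟨ρ₂, rfl, hs₂, ht₂⟩ := h₂.exists_of_append_dynamic he
  have hp := Arg.isStatic_of_isPar ho.isPar_left
  have hq := Arg.isStatic_of_isPar ho.symm.isPar_left
  -- After removing dynamic arguments, `staticPart ρ` is a common prefix of the two predecessors, so
  -- it ends no later than their point of divergence.
  have hlen : (staticPart ρ).length ≤ (staticPart σ).length := by
    have e₁ := congrArg staticPart hl
    have e₂ := congrArg staticPart hm
    rw [staticPart_append, staticPart_append, hs₁] at e₁
    rw [staticPart_append, staticPart_append, hs₂] at e₂
    rw [show staticPart (p :: a) = p :: staticPart a by simp [staticPart, hp]] at e₁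
    rw [show staticPart (q :: b) = q :: staticPart b by simp [staticPart, hq]] at e₂
    exact length_staticPart_le_of_diverge ho.ne e₁ e₂
  obtain ⟨z₁, hz₁⟩ := exists_prefix_of_length_staticPart hd hp hl (by rwa [hs₁])
  obtain ⟨z₂, hz₂⟩ := exists_prefix_of_length_staticPart he hq hm (by rwa [hs₂])
  have key : ∀ {μ ν w w' : List (Arg A Ch Bn Sg)} {c : Arg A Ch Bn Sg},
      staticPart μ = staticPart ν → tailLength μ = tailLength ν → ν = μ ++ c :: w → False := by
    intro μ ν w w' c hs ht hν
    subst hν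
    rw [staticPart_append] at hs
    have h0 : staticPart (c :: w) = [] := by simpa using hs
    rw [tailLength_append_of_staticPart h0] at ht
    simp at ht
  rcases List.append_eq_append_iff.1 (hz₁.symm.trans hz₂) with ⟨z, hz, hz'⟩ | ⟨z, hz, hz'⟩
  · cases z with
    | nil => cases hz'; exact hde rfl
    | cons c z => exact key (w' := []) (hs₁.trans hs₂.symm) (ht₁.trans ht₂.symm) hz
  · cases z with
    | nil => cases hz'; exact hde rfl
    | cons c z => exact key (w' := []) (hs₂.trans hs₁.symm) (ht₂.trans ht₁.symm) hz

/-! ### Static components -/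

/-- The largest prefix consisting of static arguments. -/
abbrev staticPrefix (l : List (Arg A Ch Bn Sg)) : List (Arg A Ch Bn Sg) :=
  l.takeWhile Arg.isStatic

theorem staticPrefix_append_dynamic {d : Arg A Ch Bn Sg} (hd : ¬ d.isStatic)
    (l m : List (Arg A Ch Bn Sg)) : staticPrefix (l ++ d :: m) = staticPrefix l := by
  induction l with
  | nil => simp [staticPrefix, hd]
  | cons a l ih => by_cases ha : a.isStatic <;> simp_all [staticPrefix]

theorem isStatic_of_mem_staticPrefix {l : List (Arg A Ch Bn Sg)} {a : Arg A Ch Bn Sg}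
    (h : a ∈ staticPrefix l) : a.isStatic :=
  List.mem_takeWhile_imp h

/-- A dynamic argument in the common prefix would end both static prefixes at the same place and
make them equal. -/
theorem staticDiverge_of_diverge {l m : List (Arg A Ch Bn Sg)} (h : Diverge l m)
    (hne : staticPrefix l ≠ staticPrefix m) : StaticDiverge l m := by
  obtain ⟨σ, p, q, x, y, h, rfl, rfl⟩ := h
  refine ⟨σ, p, q, x, y, ?_, h, rfl, rfl⟩
  by_contra! hσ
  obtain ⟨a, ha, hst⟩ := hσ
  obtain ⟨s, t, rfl⟩ := List.append_of_mem ha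
  apply hne
  rw [List.append_assoc, List.append_assoc, List.cons_append, List.cons_append,
    staticPrefix_append_dynamic hst, staticPrefix_append_dynamic hst]

theorem StaticDiverge.staticPrefix {l m : List (Arg A Ch Bn Sg)} (h : StaticDiverge l m) :
    Diverge (staticPrefix l) (Justness.staticPrefix m) := by
  obtain ⟨σ, p, q, x, y, hσ, h, rfl, rfl⟩ := h
  refine ⟨σ, p, q, Justness.staticPrefix x, Justness.staticPrefix y, h, ?_, ?_⟩
  · simp [Justness.staticPrefix, List.takeWhile_append_of_pos hσ,
      Arg.isStatic_of_isPar h.isPar_left]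
  · simp [Justness.staticPrefix, List.takeWhile_append_of_pos hσ,
      Arg.isStatic_of_isPar h.symm.isPar_left]

theorem staticDiverge_of_diverge_staticPrefix {l m : List (Arg A Ch Bn Sg)}
    (h : Diverge (staticPrefix l) (staticPrefix m)) : StaticDiverge l m := by
  obtain ⟨σ, p, q, x, y, h, h₁, h₂⟩ := h
  have e₁ := List.takeWhile_append_dropWhile (p := Arg.isStatic) (l := l)
  have e₂ := List.takeWhile_append_dropWhile (p := Arg.isStatic) (l := m)
  refine ⟨σ, p, q, x ++ l.dropWhile Arg.isStatic, y ++ m.dropWhile Arg.isStatic,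
    fun a ha => isStatic_of_mem_staticPrefix (l := l) (by rw [h₁]; simp [ha]), h, ?_, ?_⟩
  · rw [← List.cons_append, ← List.append_assoc, ← h₁, e₁]
  · rw [← List.cons_append, ← List.append_assoc, ← h₂, e₂]

theorem isComponent_of_forall_isStatic {γ : List (Arg A Ch Bn Sg)} (h : ∀ a ∈ γ, a.isStatic) :
    IsComponent γ := by
  rcases List.eq_nil_or_concat γ with rfl | ⟨σ, a, rfl⟩
  · exact .inl rfl
  · exact .inr ⟨σ, a, h _ (by simp), by simp⟩

theorem CompSucc.argsSucc {γ γ' : List (Arg A Ch Bn Sg)} (h : CompSucc γ γ') : ArgsSucc γ γ' := by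
  rcases h with rfl | ⟨σ, p, x, hp, -, rfl, rfl⟩
  · exact .inl rfl
  · exact .inr ⟨σ, p, x, hp, by simp, by simp⟩

theorem CompDirConc.diverge {γ δ : List (Arg A Ch Bn Sg)} (h : CompDirConc γ δ) : Diverge γ δ := by
  obtain ⟨σ, p, q, x, y, h, rfl, rfl⟩ := h
  exact ⟨σ, p, q, x, y, h, by simp, by simp⟩

theorem Diverge.compDirConc {γ δ : List (Arg A Ch Bn Sg)} (h : Diverge γ δ) : CompDirConc γ δ := by
  obtain ⟨σ, p, q, x, y, h, rfl, rfl⟩ := h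
  exact ⟨σ, p, q, x, y, h, by simp, by simp⟩

theorem CompConc.argsConc {γ δ : List (Arg A Ch Bn Sg)} (h : CompConc γ δ) : ArgsConc γ δ := by
  obtain ⟨γ₀, δ₀, -, -, h₁, h₂, h₃⟩ := h
  exact ⟨γ₀, δ₀, h₁.argsSucc, h₂.diverge, h₃.argsSucc⟩

/-- For static strings the predecessors may be taken to be the strings themselves. Conversely,
taking static parts brings any predecessors back to these strings. -/
theorem compConc_iff_diverge {γ δ : List (Arg A Ch Bn Sg)} (hγ : ∀ a ∈ γ, a.isStatic)
    (hδ : ∀ a ∈ δ, a.isStatic) : CompConc γ δ ↔ Diverge γ δ := by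
  constructor
  · intro h
    have := h.argsConc.diverge_staticPart
    rwa [staticPart_eq_self hγ, staticPart_eq_self hδ] at this
  · intro h
    exact ⟨γ, δ, isComponent_of_forall_isStatic hγ, isComponent_of_forall_isStatic hδ, .inl rfl,
      h.compDirConc, .inl rfl⟩

/-- A static component forgets everything from the first dynamic argument on, so a divergence is
visible in it only if no dynamic argument comes earlier. -/
theorem compConc_staticPrefix_iff {l m : List (Arg A Ch Bn Sg)} :
    CompConc (staticPrefix l) (staticPrefix m) ↔ StaticDiverge l m := by
  rw [compConc_iff_diverge (fun _ => isStatic_of_mem_staticPrefix)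
    (fun _ => isStatic_of_mem_staticPrefix)]
  exact ⟨staticDiverge_of_diverge_staticPrefix, StaticDiverge.staticPrefix⟩

theorem Diverge.filter_isPar {l m : List (Arg A Ch Bn Sg)} (h : Diverge l m) :
    Diverge (l.filter Arg.isPar) (m.filter Arg.isPar) := by
  obtain ⟨σ, p, q, x, y, h, rfl, rfl⟩ := h
  exact ⟨σ.filter Arg.isPar, p, q, x.filter Arg.isPar, y.filter Arg.isPar, h,
    by simp [h.isPar_left], by simp [h.symm.isPar_left]⟩

theorem Diverge.ne {l m : List (Arg A Ch Bn Sg)} (h : Diverge l m) : l ≠ m := by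
  rintro rfl
  exact not_diverge_append l [] (by simpa using h)

end Lists

/-! ### Derivations, their synchrons and justness. -/

section Derivations

variable {d : Dialect} {A : Type u} {Ch : Type v} {Bn : Type w} {Sg : Type x}

/-! ### Argument strings of synchrons -/

/-- The argument strings of those synchrons in `X` whose leaf satisfies `p`. -/
def leafArgs (p : Leaf d A Ch Bn Sg → Prop) (X : Set (Synchron d A Ch Bn Sg)) :
    Set (List (Arg A Ch Bn Sg)) :=
  {l | ∃ e, p e ∧ ⟨l, e⟩ ∈ X}

theorem leafArgs_app (p : Leaf d A Ch Bn Sg → Prop) (ι : Arg A Ch Bn Sg)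
    (X : Set (Synchron d A Ch Bn Sg)) :
    leafArgs p (ι.app X) = List.cons ι '' leafArgs p X := by
  ext l
  constructor
  · rintro ⟨e, he, ⟨l', e'⟩, hs, h⟩
    cases h
    exact ⟨l', ⟨_, he, hs⟩, rfl⟩
  · rintro ⟨l', ⟨e, he, hs⟩, rfl⟩
    exact ⟨e, he, ⟨l', e⟩, hs, rfl⟩

theorem leafArgs_union (p : Leaf d A Ch Bn Sg → Prop) (X Y : Set (Synchron d A Ch Bn Sg)) :
    leafArgs p (X ∪ Y) = leafArgs p X ∪ leafArgs p Y := by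
  ext l
  simp only [leafArgs, Set.mem_ofPred_eq, Set.mem_union]
  constructor
  · rintro ⟨e, he, h | h⟩
    exacts [.inl ⟨e, he, h⟩, .inr ⟨e, he, h⟩]
  · rintro (⟨e, he, h⟩ | ⟨e, he, h⟩)
    exacts [⟨e, he, .inl h⟩, ⟨e, he, .inr h⟩]

theorem leafArgs_singleton (p : Leaf d A Ch Bn Sg → Prop) (e : Leaf d A Ch Bn Sg) :
    leafArgs p {⟨[], e⟩} = {l | l = [] ∧ p e} := by
  ext l
  simp only [leafArgs, Set.mem_ofPred_eq, Set.mem_singleton_iff, Synchron.mk.injEq]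
  constructor
  · rintro ⟨_, he, rfl, rfl⟩
    exact ⟨rfl, he⟩
  · rintro ⟨rfl, he⟩
    exact ⟨e, he, rfl, rfl⟩

/-- Leaves of active synchrons. -/
def Leaf.IsActive (e : Leaf d A Ch Bn Sg) : Prop := ∃ α P, e = .act α P

/-- Leaves that perform a broadcast. -/
def Leaf.IsBroadcast (e : Leaf d A Ch Bn Sg) : Prop := ∃ b P, e = .act (.bcast b) P

/-- The labels `b!`. -/
def Label.IsBroadcast (ℓ : Label Ch Bn Sg) : Prop := ∃ b, ℓ = .act (.bcast b)

/-- Leaves of necessary synchrons of a derivation with label `ℓ`. -/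
def Leaf.IsNecessary (ℓ : Label Ch Bn Sg) (e : Leaf d A Ch Bn Sg) : Prop :=
  ℓ.IsBroadcast → e.IsBroadcast

variable {D : Spec d A Ch Bn Sg}

/-- The argument strings of the active synchrons. -/
def Der.activeArgs {φ : Formula d A Ch Bn Sg} (χ : Der D φ) : Set (List (Arg A Ch Bn Sg)) :=
  leafArgs Leaf.IsActive χ.synchrons

/-- The argument strings of the necessary synchrons. -/
def Der.necessaryArgs {φ : Formula d A Ch Bn Sg} (χ : Der D φ) : Set (List (Arg A Ch Bn Sg)) :=
  leafArgs (Leaf.IsNecessary φ.label) χ.synchrons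

theorem isBroadcast_onLabel (f : Relabelling Ch Bn Sg) (ℓ : Label Ch Bn Sg) :
    (f.onLabel ℓ).IsBroadcast ↔ ℓ.IsBroadcast := by
  rcases ℓ with α | s | b
  · cases α <;> simp [Label.IsBroadcast, Relabelling.onLabel, Relabelling.onAct]
  · simp [Label.IsBroadcast, Relabelling.onLabel]
  · simp [Label.IsBroadcast, Relabelling.onLabel]

theorem isNecessary_onLabel (f : Relabelling Ch Bn Sg) (ℓ : Label Ch Bn Sg) :
    Leaf.IsNecessary (d := d) (A := A) (f.onLabel ℓ) = Leaf.IsNecessary ℓ := by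
  funext e
  simp [Leaf.IsNecessary, isBroadcast_onLabel]

theorem Compl.not_isBroadcast {c c' : Label Ch Bn Sg} (h : Compl c c') :
    ¬ c.IsBroadcast ∧ ¬ c'.IsBroadcast := by
  cases h <;> simp [Label.IsBroadcast]

theorem isNecessary_of_not {ℓ : Label Ch Bn Sg} (h : ¬ ℓ.IsBroadcast) :
    Leaf.IsNecessary (d := d) (A := A) ℓ = fun _ => True := by
  funext e
  simp [Leaf.IsNecessary, h]

/-! ### Labels and leaves -/

/-- The labels `b!`, `b?` and `b:`. -/
def Label.HasMode (ℓ : Label Ch Bn Sg) : Prop := ∃ (m : Mode) (b : Bn), ℓ = m.label b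

/-- A broadcast leaf occurs only under a label `b!`, a discard leaf only under a label `b!`, `b?`
or `b:`. -/
def Leaf.Fits (ℓ : Label Ch Bn Sg) (e : Leaf d A Ch Bn Sg) : Prop :=
  (e.IsBroadcast → ℓ.IsBroadcast) ∧ ((∃ b, e = .disc b) → ℓ.HasMode)

theorem Leaf.Fits.mono {ℓ ℓ' : Label Ch Bn Sg} {e : Leaf d A Ch Bn Sg} (h : e.Fits ℓ)
    (h₁ : ℓ.IsBroadcast → ℓ'.IsBroadcast) (h₂ : ℓ.HasMode → ℓ'.HasMode) : e.Fits ℓ' :=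
  ⟨fun he => h₁ (h.1 he), fun he => h₂ (h.2 he)⟩

theorem Mode.hasMode_label (m : Mode) (b : Bn) : (m.label b : Label Ch Bn Sg).HasMode :=
  ⟨m, b, rfl⟩

theorem Mode.isBroadcast_label {m : Mode} {b : Bn} :
    (m.label b : Label Ch Bn Sg).IsBroadcast ↔ m = .bang := by
  cases m <;> simp [Mode.label, Label.IsBroadcast]

theorem Compl.not_hasMode {c c' : Label Ch Bn Sg} (h : Compl c c') :
    ¬ c.HasMode ∧ ¬ c'.HasMode := by
  constructor <;> rintro ⟨m, b, hm⟩ <;> cases h <;> cases m <;> cases hm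

theorem not_hasMode_sig (s : Sg) : ¬ (Label.act (.sig s) : Label Ch Bn Sg).HasMode := by
  rintro ⟨m, b, hm⟩
  cases m <;> cases hm

theorem not_hasMode_emission (s : Sg) : ¬ (Label.emission s : Label Ch Bn Sg).HasMode := by
  rintro ⟨m, b, hm⟩
  cases m <;> cases hm

theorem Label.IsBroadcast.hasMode {ℓ : Label Ch Bn Sg} (h : ℓ.IsBroadcast) : ℓ.HasMode := by
  obtain ⟨b, rfl⟩ := h
  exact ⟨.bang, b, rfl⟩

theorem Label.HasMode.onLabel {ℓ : Label Ch Bn Sg} (h : ℓ.HasMode) (f : Relabelling Ch Bn Sg) :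
    (f.onLabel ℓ).HasMode := by
  obtain ⟨m, b, rfl⟩ := h
  exact ⟨m, f.bn b, by cases m <;> rfl⟩

theorem forall_mem_app {p : Leaf d A Ch Bn Sg → Prop} {ι : Arg A Ch Bn Sg}
    {X : Set (Synchron d A Ch Bn Sg)} : (∀ s ∈ ι.app X, p s.leaf) ↔ ∀ s ∈ X, p s.leaf := by
  simp [Arg.app, Synchron.under]

/-- This has two uses: the receiving or discarding side of a broadcast contributes no necessary
synchron, and discard leaves are never necessary for a label other than `b?` and `b:`. -/
theorem fits_of_mem_synchrons {φ : Formula d A Ch Bn Sg} (χ : Der D φ) :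
    ∀ s ∈ χ.synchrons, s.leaf.Fits φ.label := by
  -- Premises of handshakes and signal reads have labels without a mode, so their synchrons have
  -- neither broadcast nor discard leaves and fit any label.
  have hbad : ∀ {c ℓ : Label Ch Bn Sg} {X : Set (Synchron d A Ch Bn Sg)}, ¬ c.HasMode →
      (∀ s ∈ X, s.leaf.Fits c) → ∀ s ∈ X, s.leaf.Fits ℓ := fun hc h s hs =>
    (h s hs).mono (fun hb => absurd hb.hasMode hc) (fun hm => absurd hm hc)
  induction χ with
  | act α P =>
    simp only [Der.synchrons, Set.mem_singleton_iff, forall_eq, Leaf.Fits]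
    refine ⟨?_, by simp⟩
    rintro ⟨b, Q, h⟩
    cases h
    exact ⟨b, rfl⟩
  | comm χ ζ hc ih₁ ih₂ =>
    simp only [Der.synchrons, Set.mem_union, or_imp, forall_and, forall_mem_app]
    exact ⟨hbad hc.not_hasMode.1 ih₁, hbad hc.not_hasMode.2 ih₂⟩
  | readR ξ χ ih₁ ih₂ =>
    simp only [Der.synchrons, Set.mem_union, or_imp, forall_and, forall_mem_app]
    exact ⟨hbad (not_hasMode_emission _) ih₁, hbad (not_hasMode_sig _) ih₂⟩
  | readL χ ξ ih₁ ih₂ =>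
    simp only [Der.synchrons, Set.mem_union, or_imp, forall_and, forall_mem_app]
    exact ⟨hbad (not_hasMode_sig _) ih₁, hbad (not_hasMode_emission _) ih₂⟩
  | rel χ f hf hℓ ih =>
    subst hℓ
    simp only [Der.synchrons, forall_mem_app]
    exact fun s hs => (ih s hs).mono (isBroadcast_onLabel f _).2 (fun h => h.onLabel f)
  | emitRel ξ f hf hs ih =>
    simp only [Der.synchrons, forall_mem_app]
    exact hbad (not_hasMode_emission _) ih
  | broC b m₁ m₂ m χ ζ hm hℓ ih₁ ih₂ =>
    subst hℓ
    simp only [Der.synchrons, Set.mem_union, or_imp, forall_and, forall_mem_app]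
    refine ⟨fun s hs => (ih₁ s hs).mono ?_ fun _ => Mode.hasMode_label _ _,
      fun s hs => (ih₂ s hs).mono ?_ fun _ => Mode.hasMode_label _ _⟩
    · simp only [Formula.label, Mode.isBroadcast_label]
      rintro rfl
      cases m₂ <;> simp_all [Mode.comp]
    · simp only [Formula.label, Mode.isBroadcast_label]
      rintro rfl
      cases m₁ <;> simp_all [Mode.comp]
  | disNil hd b =>
    simp only [Der.synchrons, Set.mem_singleton_iff, forall_eq, Leaf.Fits]
    exact ⟨by simp [Leaf.IsBroadcast], fun _ => ⟨.colon, b, rfl⟩⟩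
  | disPre hd b α P hα =>
    simp only [Der.synchrons, Set.mem_singleton_iff, forall_eq, Leaf.Fits]
    exact ⟨by simp [Leaf.IsBroadcast], fun _ => ⟨.colon, b, rfl⟩⟩
  | disSum χ ζ ih₁ ih₂ =>
    simp only [Der.synchrons, Set.mem_union, or_imp, forall_and, forall_mem_app]
    exact ⟨ih₁, ih₂⟩
  | emit hd P s =>
    simp only [Der.synchrons, Set.mem_singleton_iff, forall_eq, Leaf.Fits]
    simp [Leaf.IsBroadcast]
  | emt hd P s =>
    simp only [Der.synchrons, Set.mem_singleton_iff, forall_eq, Leaf.Fits]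
    simp [Leaf.IsBroadcast]
  | _ => simpa only [Der.synchrons, forall_mem_app]

theorem leafArgs_eq_empty_iff {p : Leaf d A Ch Bn Sg → Prop} {X : Set (Synchron d A Ch Bn Sg)} :
    leafArgs p X = ∅ ↔ ∀ s ∈ X, ¬ p s.leaf := by
  rw [Set.eq_empty_iff_forall_notMem]
  constructor
  · exact fun h s hs hp => h s.args ⟨s.leaf, hp, hs⟩
  · rintro h l ⟨e, he, hs⟩
    exact h _ hs he

/-- The labels that are actions. -/
def Label.IsAction (ℓ : Label Ch Bn Sg) : Prop := ∃ α, ℓ = .act α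

theorem isAction_onLabel {f : Relabelling Ch Bn Sg} {ℓ : Label Ch Bn Sg} :
    (f.onLabel ℓ).IsAction ↔ ℓ.IsAction := by
  rcases ℓ with α | s | b <;> simp [Label.IsAction, Relabelling.onLabel]

theorem Mode.isAction_label {m : Mode} {b : Bn} :
    (m.label b : Label Ch Bn Sg).IsAction ↔ m ≠ .colon := by
  cases m <;> simp [Mode.label, Label.IsAction]

/-- Signal emissions and discards do not change the state. -/
def Formula.IsLoop : Formula d A Ch Bn Sg → Prop
  | .trans P _ Q => Q = P
  | .emits _ _ => True

/-- Such derivations end in emission or discard leaves only, and their rules restore the state. They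
can therefore be treated as idle steps. -/
theorem isLoop_and_activeArgs_eq_empty {φ : Formula d A Ch Bn Sg} (χ : Der D φ)
    (h : ¬ φ.label.IsAction) : φ.IsLoop ∧ χ.activeArgs = ∅ := by
  induction χ with
  | parL χ Q hη ih | parR Q χ hη ih | res χ L hη ih =>
    obtain ⟨h₁, h₂⟩ := ih h
    simp only [Der.activeArgs, Formula.IsLoop] at h₁ h₂
    simp [Der.activeArgs, Der.synchrons, Formula.IsLoop, leafArgs_app, h₁, h₂]
  | rel χ f hf hℓ ih =>
    subst hℓ
    obtain ⟨h₁, h₂⟩ := ih fun h' => h (isAction_onLabel.2 h')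
    simp only [Der.activeArgs, Formula.IsLoop] at h₁ h₂
    simp [Der.activeArgs, Der.synchrons, Formula.IsLoop, leafArgs_app, h₁, h₂]
  | broC b m₁ m₂ m χ ζ hm hℓ ih₁ ih₂ =>
    subst hℓ
    simp only [Formula.label, Mode.isAction_label, not_not] at h ih₁ ih₂
    subst h
    have hm₁ : m₁ = .colon ∧ m₂ = .colon := by cases m₁ <;> cases m₂ <;> simp_all [Mode.comp]
    obtain ⟨h₁, h₂⟩ := ih₁ hm₁.1
    obtain ⟨h₃, h₄⟩ := ih₂ hm₁.2
    simp only [Der.activeArgs, Formula.IsLoop] at h₁ h₂ h₃ h₄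
    simp [Der.activeArgs, Der.synchrons, Formula.IsLoop, leafArgs_app, leafArgs_union, h₁, h₂, h₃,
      h₄]
  | broL hd b m χ F hF hℓ ih | broR hd b m F hF χ hℓ ih =>
    obtain ⟨h₁, h₂⟩ := ih h
    simp only [Der.activeArgs, Formula.IsLoop] at h₁ h₂
    simp [Der.activeArgs, Der.synchrons, Formula.IsLoop, leafArgs_app, h₁, h₂]
  | disSum χ ζ ih₁ ih₂ =>
    obtain ⟨h₁, h₂⟩ := ih₁ h
    obtain ⟨h₃, h₄⟩ := ih₂ h
    simp only [Der.activeArgs, Formula.IsLoop] at h₁ h₂ h₃ h₄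
    simp [Der.activeArgs, Der.synchrons, Formula.IsLoop, leafArgs_app, leafArgs_union, h₁, h₂, h₃,
      h₄]
  | disAgent a χ ih =>
    obtain ⟨h₁, h₂⟩ := ih h
    simp only [Der.activeArgs, Formula.IsLoop] at h₁ h₂
    simp [Der.activeArgs, Der.synchrons, Formula.IsLoop, leafArgs_app, h₂]
  | emtAgent a χ ih =>
    obtain ⟨h₁, h₂⟩ := ih h
    simp only [Der.activeArgs, Formula.IsLoop] at h₁ h₂
    simp [Der.activeArgs, Der.synchrons, Formula.IsLoop, leafArgs_app, h₂]
  | disNil hd b | disPre hd b α P hα | emit hd P s | emt hd P s =>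
    simp [Der.activeArgs, Der.synchrons, Formula.IsLoop, leafArgs_singleton, Leaf.IsActive]
  | emtSumL χ Q ih | emtSumR Q χ ih | emtSig χ r ih =>
    obtain ⟨h₁, h₂⟩ := ih h
    simp only [Der.activeArgs, Formula.IsLoop] at h₁ h₂
    simp [Der.activeArgs, Der.synchrons, Formula.IsLoop, leafArgs_app, h₁, h₂]
  | emitSumL χ Q ih | emitSumR Q χ ih | emitParL χ Q ih | emitParR Q χ ih | emitSig χ r ih
  | emitAgent a χ ih =>
    obtain ⟨h₁, h₂⟩ := ih h
    simp only [Der.activeArgs] at h₂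
    simp [Der.activeArgs, Der.synchrons, Formula.IsLoop, leafArgs_app, h₂]
  | emitRes χ L hs ih =>
    obtain ⟨h₁, h₂⟩ := ih h
    simp only [Der.activeArgs] at h₂
    simp [Der.activeArgs, Der.synchrons, Formula.IsLoop, leafArgs_app, h₂]
  | emitRel χ f hf hs ih =>
    obtain ⟨h₁, h₂⟩ := ih (by simp [Formula.label, Label.IsAction])
    simp only [Der.activeArgs] at h₂
    simp [Der.activeArgs, Der.synchrons, Formula.IsLoop, leafArgs_app, h₂]
  | _ => exact absurd ⟨_, rfl⟩ h

/-- In a signal read the active synchron comes from the reader, and in a receipt or broadcast from a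
side that does not discard. -/
theorem activeArgs_nonempty {φ : Formula d A Ch Bn Sg} (χ : Der D φ)
    (h : φ.label.IsAction) : χ.activeArgs.Nonempty := by
  induction χ with
  | act α P =>
    exact ⟨[], .act α P, ⟨_, _, rfl⟩, rfl⟩
  | comm χ ζ hc ih₁ ih₂ =>
    simp only [Der.activeArgs, Der.synchrons, leafArgs_app, leafArgs_union, Set.union_nonempty,
      Set.image_nonempty]
    cases hc with
    | emission s => exact .inr (ih₂ ⟨_, rfl⟩)
    | _ => exact .inl (ih₁ ⟨_, rfl⟩)
  | rel χ f hf hℓ ih =>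
    subst hℓ
    simp only [Der.activeArgs, Der.synchrons, leafArgs_app, Set.image_nonempty]
    exact ih (isAction_onLabel.1 h)
  | broC b m₁ m₂ m χ ζ hm hℓ ih₁ ih₂ =>
    subst hℓ
    simp only [Formula.label, Mode.isAction_label] at h ih₁ ih₂
    simp only [Der.activeArgs, Der.synchrons, leafArgs_app, leafArgs_union, Set.union_nonempty,
      Set.image_nonempty]
    by_cases hm₁ : m₁ = .colon
    · refine .inr (ih₂ ?_)
      rintro rfl
      subst hm₁
      simp_all [Mode.comp]
    · exact .inl (ih₁ hm₁)
  | readR ξ χ ih₁ ih₂ =>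
    simp only [Der.activeArgs, Der.synchrons, leafArgs_app, leafArgs_union, Set.union_nonempty,
      Set.image_nonempty]
    exact .inr (ih₂ ⟨_, rfl⟩)
  | readL χ ξ ih₁ ih₂ =>
    simp only [Der.activeArgs, Der.synchrons, leafArgs_app, leafArgs_union, Set.union_nonempty,
      Set.image_nonempty]
    exact .inl (ih₁ ⟨_, rfl⟩)
  | sumL χ Q ih | sumR Q χ ih | parL χ Q hη ih | parR Q χ hη ih | res χ L hη ih | agent a χ ih
  | broL hd b m χ F hF hℓ ih | broR hd b m F hF χ hℓ ih | sigAct χ r ih =>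
    simp only [Der.activeArgs, Der.synchrons, leafArgs_app, Set.image_nonempty]
    exact ih h
  | _ =>
    obtain ⟨α, hα⟩ := h
    cases hα

theorem synchrons_nonempty {φ : Formula d A Ch Bn Sg} (χ : Der D φ) : χ.synchrons.Nonempty := by
  induction χ with
  | act α P => exact ⟨_, rfl⟩
  | disNil hd b => exact ⟨_, rfl⟩
  | disPre hd b α P hα => exact ⟨_, rfl⟩
  | emit hd P s => exact ⟨_, rfl⟩
  | emt hd P s => exact ⟨_, rfl⟩
  | _ => simp_all [Der.synchrons, Arg.app]

theorem synchrons_finite {φ : Formula d A Ch Bn Sg} (χ : Der D φ) : χ.synchrons.Finite := by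
  induction χ with
  | _ => simp_all [Der.synchrons, Arg.app, Set.Finite.image]

theorem necessaryArgs_finite {φ : Formula d A Ch Bn Sg} (χ : Der D φ) :
    χ.necessaryArgs.Finite := by
  refine ((synchrons_finite χ).image Synchron.args).subset ?_
  rintro l ⟨e, -, hs⟩
  exact ⟨_, hs, rfl⟩

theorem exists_isBroadcast_leaf {φ : Formula d A Ch Bn Sg} (χ : Der D φ)
    (h : φ.label.IsBroadcast) : (leafArgs Leaf.IsBroadcast χ.synchrons).Nonempty := by
  induction χ with
  | act α P =>
    obtain ⟨b, hb⟩ := h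
    cases hb
    exact ⟨[], .act (.bcast b) P, ⟨_, _, rfl⟩, rfl⟩
  | rel χ f hf hℓ ih =>
    subst hℓ
    simp only [Der.synchrons, leafArgs_app, Set.image_nonempty]
    exact ih ((isBroadcast_onLabel _ _).1 h)
  | broC b m₁ m₂ m χ ζ hm hℓ ih₁ ih₂ =>
    subst hℓ
    simp only [Formula.label, Mode.isBroadcast_label] at h ih₁ ih₂
    simp only [Der.synchrons, leafArgs_app, leafArgs_union, Set.union_nonempty, Set.image_nonempty]
    subst h
    have : m₁ = .bang ∨ m₂ = .bang := by cases m₁ <;> cases m₂ <;> simp_all [Mode.comp]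
    exact this.imp ih₁ ih₂
  | sumL χ Q ih | sumR Q χ ih | parL χ Q hη ih | parR Q χ hη ih | res χ L hη ih | agent a χ ih
  | broL hd b m χ F hF hℓ ih | broR hd b m F hF χ hℓ ih | sigAct χ r ih =>
    simp only [Der.synchrons, leafArgs_app, Set.image_nonempty]
    exact ih h
  | _ =>
    obtain ⟨α, hα⟩ := h
    cases hα

theorem necessaryArgs_nonempty {φ : Formula d A Ch Bn Sg} (χ : Der D φ) :
    χ.necessaryArgs.Nonempty := by
  by_cases h : φ.label.IsBroadcast
  · obtain ⟨l, e, he, hs⟩ := exists_isBroadcast_leaf χ h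
    exact ⟨l, e, fun _ => he, hs⟩
  · obtain ⟨s, hs⟩ := synchrons_nonempty χ
    exact ⟨s.args, s.leaf, fun h' => absurd h' h, hs⟩

/-! ### Stripping and divergence below a common first argument. -/

theorem strip_image_cons_of_not_isStatic {a : Arg A Ch Bn Sg} (ha : ¬ a.isStatic)
    {V : Set (List (Arg A Ch Bn Sg))} (hV : V.Nonempty) (N : Set (List (Arg A Ch Bn Sg))) :
    (fun l => strip l (List.cons a '' V)) '' (List.cons a '' N) = (fun l => strip l V) '' N := by
  rw [Set.image_image]
  refine Set.image_congr fun l _ => ?_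
  rw [strip_cons_of_not_isStatic ha _ (hV.image _)]
  simp

theorem strip_image_cons_of_isStatic {a : Arg A Ch Bn Sg} (ha : a.isStatic)
    (V : Set (List (Arg A Ch Bn Sg))) (N : Set (List (Arg A Ch Bn Sg))) :
    (fun l => strip l (List.cons a '' V)) '' (List.cons a '' N) =
      List.cons a '' ((fun l => strip l V) '' N) := by
  rw [Set.image_image, Set.image_image]
  refine Set.image_congr fun l _ => ?_
  rw [strip_cons_of_isStatic ha]
  simp

theorem strip_image_empty (N : Set (List (Arg A Ch Bn Sg))) :
    (fun l => strip l ∅) '' N = N := by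
  simp

theorem strip_image_parL (V W : Set (List (Arg A Ch Bn Sg))) (N : Set (List (Arg A Ch Bn Sg))) :
    (fun l => strip l (List.cons .parL '' V ∪ List.cons .parR '' W)) '' (List.cons .parL '' N) =
      List.cons .parL '' ((fun l => strip l V) '' N) := by
  rw [Set.image_image, Set.image_image]
  refine Set.image_congr fun l _ => ?_
  rw [strip_cons_of_isStatic rfl]
  simp

theorem strip_image_parR (V W : Set (List (Arg A Ch Bn Sg))) (N : Set (List (Arg A Ch Bn Sg))) :
    (fun l => strip l (List.cons .parL '' V ∪ List.cons .parR '' W)) '' (List.cons .parR '' N) =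
      List.cons .parR '' ((fun l => strip l W) '' N) := by
  rw [Set.image_image, Set.image_image]
  refine Set.image_congr fun l _ => ?_
  rw [strip_cons_of_isStatic rfl]
  simp

/-- All pairs of argument strings from `N` and `V` diverge. -/
def AllDiverge (N V : Set (List (Arg A Ch Bn Sg))) : Prop :=
  ∀ l ∈ N, ∀ m ∈ V, Diverge l m

theorem AllDiverge.of_cons {a : Arg A Ch Bn Sg} {N V N' V' : Set (List (Arg A Ch Bn Sg))}
    (h : AllDiverge N' V') (hN : List.cons a '' N ⊆ N') (hV : List.cons a '' V ⊆ V') :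
    AllDiverge N V := fun l hl m hm =>
  diverge_cons_cons.1 (h _ (hN ⟨l, hl, rfl⟩) _ (hV ⟨m, hm, rfl⟩))

/-- When the argument of a dynamic operator acts, the operator vanishes, and `strip` deletes exactly
that argument. The predicate `C` is instantiated with persistence, whose target is then the same
with and without the operator. -/
theorem AllDiverge.of_cons_dynamic {a : Arg A Ch Bn Sg} (ha : ¬ a.isStatic)
    {N V : Set (List (Arg A Ch Bn Sg))} (hV : V.Nonempty)
    (h : AllDiverge (List.cons a '' N) (List.cons a '' V)) {C : Set (List (Arg A Ch Bn Sg)) → Prop}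
    (hC : AllDiverge N V → C ((fun l => strip l V) '' N)) :
    C ((fun l => strip l (List.cons a '' V)) '' (List.cons a '' N)) := by
  rw [strip_image_cons_of_not_isStatic ha hV]
  exact hC (h.of_cons subset_rfl subset_rfl)

/-- Strings that start with different arguments can diverge only at a parallel composition. This
excludes that the other summand of a choice has moved. -/
theorem AllDiverge.elim {a b : Arg A Ch Bn Sg} {N V : Set (List (Arg A Ch Bn Sg))}
    (h : AllDiverge (List.cons a '' N) (List.cons b '' V)) (ha : ¬ a.isPar) (hab : a ≠ b)
    (hN : N.Nonempty) (hV : V.Nonempty) : False := by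
  obtain ⟨l, hl⟩ := hN
  obtain ⟨m, hm⟩ := hV
  rcases (h _ ⟨l, hl, rfl⟩ _ ⟨m, hm, rfl⟩).cons_eq with ho | ⟨hab', -⟩
  · exact ha ho.isPar_left
  · exact hab hab'

/-! ### Moves of processes -/

/-- The process `P` stays put, or performs a transition to `P'`; the active synchrons involved have
the argument strings `V`. -/
def Moves (D : Spec d A Ch Bn Sg) (P P' : Proc d A Ch Bn Sg) (V : Set (List (Arg A Ch Bn Sg))) :
    Prop :=
  (P' = P ∧ V = ∅) ∨ ∃ ℓ, ∃ χ : Der D (.trans P ℓ P'), V = χ.activeArgs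

/-- A move that is not idle is an action. -/
theorem Moves.cases {P P' : Proc d A Ch Bn Sg} {V : Set (List (Arg A Ch Bn Sg))}
    (h : Moves D P P' V) : (P' = P ∧ V = ∅) ∨ ∃ α, ∃ χ : Der D (.trans P (.act α) P'),
      V = χ.activeArgs := by
  rcases h with h | ⟨ℓ, χ, rfl⟩
  · exact .inl h
  · by_cases hℓ : ℓ.IsAction
    · obtain ⟨α, rfl⟩ := hℓ
      exact .inr ⟨α, χ, rfl⟩
    · exact .inl (isLoop_and_activeArgs_eq_empty χ hℓ)

theorem Der.moves {P P' : Proc d A Ch Bn Sg} {ℓ} (χ : Der D (.trans P ℓ P')) :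
    Moves D P P' χ.activeArgs :=
  .inr ⟨ℓ, χ, rfl⟩

theorem moves_refl (P : Proc d A Ch Bn Sg) : Moves D P P ∅ := .inl ⟨rfl, rfl⟩

theorem Moves.pre {α : Act Ch Bn Sg} {P R : Proc d A Ch Bn Sg} {V : Set (List (Arg A Ch Bn Sg))}
    (h : Moves D (.pre α P) R V) : (R = .pre α P ∧ V = ∅) ∨ V = {[]} := by
  rcases h.cases with h | ⟨β, χ, rfl⟩
  · exact .inl h
  · cases χ
    right
    simp [Der.activeArgs, Der.synchrons, leafArgs_singleton, Leaf.IsActive]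

/-- By `Moves.cases` a move that is not idle is an action, so emissions and discards, which keep the
choice in place, fall under the first case. Nonemptiness of `W` is needed for `strip` to remove the
choice. -/
theorem Moves.sum {P Q R : Proc d A Ch Bn Sg} {V : Set (List (Arg A Ch Bn Sg))}
    (h : Moves D (.sum P Q) R V) : (R = .sum P Q ∧ V = ∅) ∨
      (∃ W, W.Nonempty ∧ Moves D P R W ∧ V = List.cons .sumL '' W) ∨
      (∃ W, W.Nonempty ∧ Moves D Q R W ∧ V = List.cons .sumR '' W) := by
  rcases h.cases with h | ⟨β, χ, rfl⟩
  · exact .inl h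
  · cases χ with
    | sumL χ => exact .inr (.inl ⟨_, activeArgs_nonempty χ ⟨_, rfl⟩, χ.moves, leafArgs_app _ _ _⟩)
    | sumR _ χ => exact .inr (.inr ⟨_, activeArgs_nonempty χ ⟨_, rfl⟩, χ.moves, leafArgs_app _ _ _⟩)

theorem Moves.signal {P R : Proc d A Ch Bn Sg} {r : Sg} {V : Set (List (Arg A Ch Bn Sg))}
    (h : Moves D (.signal P r) R V) : (R = .signal P r ∧ V = ∅) ∨
      (∃ W, W.Nonempty ∧ Moves D P R W ∧ V = List.cons (.signal r) '' W) := by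
  rcases h.cases with h | ⟨β, χ, rfl⟩
  · exact .inl h
  · cases χ with
    | sigAct χ => exact .inr ⟨_, activeArgs_nonempty χ ⟨_, rfl⟩, χ.moves, leafArgs_app _ _ _⟩

theorem Moves.agent {a : A} {R : Proc d A Ch Bn Sg} {V : Set (List (Arg A Ch Bn Sg))}
    (h : Moves D (.agent a) R V) : (R = .agent a ∧ V = ∅) ∨
      (∃ W, W.Nonempty ∧ Moves D (D.defn a) R W ∧ V = List.cons (.agent a) '' W) := by
  rcases h.cases with h | ⟨β, χ, rfl⟩
  · exact .inl h
  · cases χ with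
    | agent _ χ => exact .inr ⟨_, activeArgs_nonempty χ ⟨_, rfl⟩, χ.moves, leafArgs_app _ _ _⟩

theorem Moves.res {P R : Proc d A Ch Bn Sg} {L : Set (Ch ⊕ Sg)} {V : Set (List (Arg A Ch Bn Sg))}
    (h : Moves D (.res P L) R V) :
    ∃ P' W, R = .res P' L ∧ Moves D P P' W ∧ V = List.cons (.res L) '' W := by
  rcases h.cases with ⟨rfl, rfl⟩ | ⟨β, χ, rfl⟩
  · exact ⟨P, ∅, rfl, moves_refl P, by simp⟩
  · cases χ with
    | res χ => exact ⟨_, _, rfl, χ.moves, leafArgs_app _ _ _⟩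

theorem Moves.rel {P R : Proc d A Ch Bn Sg} {f : Relabelling Ch Bn Sg} {hf : f.Admissible d}
    {V : Set (List (Arg A Ch Bn Sg))} (h : Moves D (.rel P f hf) R V) :
    ∃ P' W, R = .rel P' f hf ∧ Moves D P P' W ∧ V = List.cons (.rel f) '' W := by
  rcases h.cases with ⟨rfl, rfl⟩ | ⟨β, χ, rfl⟩
  · exact ⟨P, ∅, rfl, moves_refl P, by simp⟩
  · cases χ with
    | rel χ => exact ⟨_, _, rfl, χ.moves, leafArgs_app _ _ _⟩

/-- Since idling counts as a move, all rules for parallel composition take one form. In a signal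
read the emitting side is idle: an indicator has no active synchrons and leaves its process as it
is. -/
theorem Moves.par {P Q R : Proc d A Ch Bn Sg} {V : Set (List (Arg A Ch Bn Sg))}
    (h : Moves D (.par P Q) R V) :
    ∃ P' Q' W₁ W₂, R = .par P' Q' ∧ Moves D P P' W₁ ∧ Moves D Q Q' W₂ ∧
      V = List.cons .parL '' W₁ ∪ List.cons .parR '' W₂ := by
  have hleft : ∀ X : Set (Synchron d A Ch Bn Sg), leafArgs Leaf.IsActive (Arg.parL.app X) =
      List.cons .parL '' leafArgs Leaf.IsActive X ∪ List.cons .parR '' ∅ := by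
    simp [leafArgs_app]
  have hright : ∀ X : Set (Synchron d A Ch Bn Sg), leafArgs Leaf.IsActive (Arg.parR.app X) =
      List.cons .parL '' ∅ ∪ List.cons .parR '' leafArgs Leaf.IsActive X := by
    simp [leafArgs_app]
  have hboth : ∀ X Y : Set (Synchron d A Ch Bn Sg),
      leafArgs Leaf.IsActive (Arg.parL.app X ∪ Arg.parR.app Y) =
      List.cons .parL '' leafArgs Leaf.IsActive X ∪
        List.cons .parR '' leafArgs Leaf.IsActive Y := by
    simp [leafArgs_app, leafArgs_union]
  rcases h.cases with ⟨rfl, rfl⟩ | ⟨β, χ, rfl⟩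
  · exact ⟨P, Q, ∅, ∅, rfl, moves_refl P, moves_refl Q, by simp⟩
  · cases χ with
    | parL χ => exact ⟨_, _, _, _, rfl, χ.moves, moves_refl Q, hleft _⟩
    | parR _ ζ => exact ⟨_, _, _, _, rfl, moves_refl P, ζ.moves, hright _⟩
    | broL _ _ _ χ => exact ⟨_, _, _, _, rfl, χ.moves, moves_refl Q, hleft _⟩
    | broR _ _ _ _ _ ζ => exact ⟨_, _, _, _, rfl, moves_refl P, ζ.moves, hright _⟩
    | comm χ ζ => exact ⟨_, _, _, _, rfl, χ.moves, ζ.moves, hboth _ _⟩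
    | broC _ _ _ _ χ ζ => exact ⟨_, _, _, _, rfl, χ.moves, ζ.moves, hboth _ _⟩
    | readR ξ χ =>
      have := (isLoop_and_activeArgs_eq_empty ξ (by simp [Formula.label, Label.IsAction])).2
      refine ⟨_, _, _, _, rfl, moves_refl P, χ.moves, (hboth _ _).trans ?_⟩
      rw [show leafArgs Leaf.IsActive ξ.synchrons = ∅ from this]
      rfl
    | readL χ ξ =>
      have := (isLoop_and_activeArgs_eq_empty ξ (by simp [Formula.label, Label.IsAction])).2
      refine ⟨_, _, _, _, rfl, χ.moves, moves_refl Q, (hboth _ _).trans ?_⟩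
      rw [show leafArgs Leaf.IsActive ξ.synchrons = ∅ from this]
      rfl

/-! ### Broadcasts cannot be blocked -/

/-- The disjunction in `hP` permits two passes: first over guarded right-hand sides, where
structural induction never meets an agent identifier, then over all processes, with identifiers
settled by the first pass. -/
theorem exists_query_or_colon_aux (hd : d = .abcd) (P : Proc d A Ch Bn Sg)
    (hP : P.Guarded ∨ ∀ a b, ∃ (m : Mode) (Q : _), m ≠ .bang ∧
      Nonempty (Der D (.trans (D.defn a) (m.label b) Q))) :
    ∀ b, ∃ (m : Mode) (Q : _), m ≠ .bang ∧ Nonempty (Der D (.trans P (m.label b) Q)) := by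
  have hS : IsEmpty Sg := D.noSignals (by subst hd; simp [Dialect.HasSignals])
  induction P with
  | nil => exact fun b => ⟨.colon, _, by simp, ⟨.disNil hd b⟩⟩
  | pre α P =>
    intro b
    by_cases hα : α = .recv b
    · subst hα
      exact ⟨.query, _, by simp, ⟨.act _ _⟩⟩
    · exact ⟨.colon, _, by simp, ⟨.disPre hd b α P hα⟩⟩
  | sum P Q ihP ihQ =>
    intro b
    obtain ⟨m₁, P', hm₁, ⟨χ⟩⟩ := ihP (hP.imp_left (·.1)) b
    obtain ⟨m₂, Q', hm₂, ⟨ζ⟩⟩ := ihQ (hP.imp_left (·.2)) b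
    cases m₁ with
    | bang => exact absurd rfl hm₁
    | query => exact ⟨.query, _, by simp, ⟨.sumL χ _⟩⟩
    | colon =>
      cases m₂ with
      | bang => exact absurd rfl hm₂
      | query => exact ⟨.query, _, by simp, ⟨.sumR _ ζ⟩⟩
      | colon => exact ⟨.colon, _, by simp, ⟨.disSum χ ζ⟩⟩
  | par P Q ihP ihQ =>
    intro b
    obtain ⟨m₁, P', hm₁, ⟨χ⟩⟩ := ihP (hP.imp_left (·.1)) b
    obtain ⟨m₂, Q', hm₂, ⟨ζ⟩⟩ := ihQ (hP.imp_left (·.2)) b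
    have : ∃ m, m₁.comp m₂ = some m ∧ m ≠ .bang := by
      cases m₁ <;> cases m₂ <;> simp_all [Mode.comp]
    obtain ⟨m, hm, hm'⟩ := this
    exact ⟨m, _, hm', ⟨.broC b m₁ m₂ m χ ζ hm rfl⟩⟩
  | res P L ih =>
    intro b
    obtain ⟨m, P', hm, ⟨χ⟩⟩ := ih hP b
    exact ⟨m, _, hm, ⟨.res χ L (by cases m <;> simp [Mode.label, Label.Restricted])⟩⟩
  | rel P f hf ih =>
    intro b
    -- Surjectivity on broadcast names enters here: without a preimage of `b` the relabelled process
    -- could neither receive nor discard `b`.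
    obtain ⟨b', rfl⟩ := hf hd b
    obtain ⟨m, P', hm, ⟨χ⟩⟩ := ih hP b'
    exact ⟨m, _, hm, ⟨.rel χ f hf (by cases m <;> rfl)⟩⟩
  | agent a =>
    intro b
    obtain ⟨m, P', hm, ⟨χ⟩⟩ := (hP.resolve_left fun h => h) a b
    cases m with
    | bang => exact absurd rfl hm
    | query => exact ⟨.query, _, hm, ⟨.agent a χ⟩⟩
    | colon => exact ⟨.colon, _, hm, ⟨.disAgent a χ⟩⟩
  | signal P s ih => exact hS.elim s

/-- In ABCd each process can receive or discard each broadcast. -/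
theorem exists_query_or_colon (D : Spec d A Ch Bn Sg) (hd : d = .abcd) (P : Proc d A Ch Bn Sg)
    (b : Bn) :
    ∃ (m : Mode) (Q : _), m ≠ .bang ∧ Nonempty (Der D (.trans P (m.label b) Q)) :=
  exists_query_or_colon_aux hd P (.inr fun a =>
    exists_query_or_colon_aux hd _ (.inl (D.guarded (.inr hd) a))) b

theorem leafArgs_isNecessary_eq_empty {F F' : Proc d A Ch Bn Sg} {m : Mode} {b : Bn}
    (ζ : Der D (.trans F (m.label b) F')) (hm : m ≠ .bang) :
    leafArgs (Leaf.IsNecessary (.act (.bcast b))) ζ.synchrons = ∅ := by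
  refine leafArgs_eq_empty_iff.2 fun s hs hn => hm ?_
  exact Mode.isBroadcast_label.1 ((fits_of_mem_synchrons ζ s hs).1 (hn ⟨b, rfl⟩))

theorem necessaryArgs_of_broadcast_left {E E' F F' : Proc d A Ch Bn Sg} {m : Mode} {b : Bn}
    (χ : Der D (.trans E (.act (.bcast b)) E')) (ζ : Der D (.trans F (m.label b) F'))
    (hm : m ≠ .bang) :
    leafArgs (Leaf.IsNecessary (.act (.bcast b)))
      (Arg.parL.app χ.synchrons ∪ Arg.parR.app ζ.synchrons) =
        List.cons .parL '' χ.necessaryArgs := by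
  rw [leafArgs_union, leafArgs_app, leafArgs_app, leafArgs_isNecessary_eq_empty ζ hm,
    Set.image_empty, Set.union_empty]
  rfl

theorem necessaryArgs_of_broadcast_right {E E' F F' : Proc d A Ch Bn Sg} {m : Mode} {b : Bn}
    (χ : Der D (.trans E (.act (.bcast b)) E')) (ζ : Der D (.trans F (m.label b) F'))
    (hm : m ≠ .bang) :
    leafArgs (Leaf.IsNecessary (.act (.bcast b)))
      (Arg.parL.app ζ.synchrons ∪ Arg.parR.app χ.synchrons) =
        List.cons .parR '' χ.necessaryArgs := by
  rw [leafArgs_union, leafArgs_app, leafArgs_app, leafArgs_isNecessary_eq_empty ζ hm,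
    Set.image_empty, Set.empty_union]
  rfl

theorem Mode.comp_eq_bang {m₁ m₂ : Mode} (h : m₁.comp m₂ = some .bang) :
    (m₁ = .bang ∧ m₂ ≠ .bang) ∨ (m₂ = .bang ∧ m₁ ≠ .bang) := by
  cases m₁ <;> cases m₂ <;> simp [Mode.comp] at h ⊢

/-- A broadcast can be completed by any process put in parallel. -/
theorem exists_par_broadcast {E E' F : Proc d A Ch Bn Sg} {b : Bn}
    (χ : Der D (.trans E (.act (.bcast b)) E')) :
    (∃ F', ∃ χ' : Der D (.trans (.par E F) (.act (.bcast b)) (.par E' F')),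
      χ'.necessaryArgs = List.cons .parL '' χ.necessaryArgs) ∧
    (∃ F', ∃ χ' : Der D (.trans (.par F E) (.act (.bcast b)) (.par F' E')),
      χ'.necessaryArgs = List.cons .parR '' χ.necessaryArgs) := by
  have hcomp : ∀ {m : Mode}, m ≠ .bang → Mode.bang.comp m = some .bang ∧
      m.comp .bang = some .bang := by
    intro m hm
    cases m <;> simp_all [Mode.comp]
  have hmode : (∃ (m : Mode) (F' : _), m ≠ .bang ∧ Nonempty (Der D (.trans F (m.label b) F'))) →
      (∃ F', ∃ χ' : Der D (.trans (.par E F) (.act (.bcast b)) (.par E' F')),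
        χ'.necessaryArgs = List.cons .parL '' χ.necessaryArgs) ∧
      (∃ F', ∃ χ' : Der D (.trans (.par F E) (.act (.bcast b)) (.par F' E')),
        χ'.necessaryArgs = List.cons .parR '' χ.necessaryArgs) := by
    rintro ⟨m, F', hm, ⟨ζ⟩⟩
    exact ⟨⟨F', .broC b .bang m .bang χ ζ (hcomp hm).1 rfl,
        necessaryArgs_of_broadcast_left χ ζ hm⟩,
      ⟨F', .broC b m .bang .bang ζ χ (hcomp hm).2 rfl, necessaryArgs_of_broadcast_right χ ζ hm⟩⟩
  by_cases hB : d.HasBroadcast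
  · rcases hB with hd | hd
    -- In ABC the joint rule applies if `F` can receive `b`, and the rule with the negative premise
    -- if it cannot.
    · by_cases hF : Receives D b F
      · obtain ⟨F', ζ⟩ := (receives_iff D hd b F).1 hF
        exact hmode ⟨.query, F', by simp, ζ⟩
      · exact ⟨⟨F, .broL hd b .bang χ F hF rfl, leafArgs_app _ _ _⟩,
          ⟨F, .broR hd b .bang F hF χ rfl, leafArgs_app _ _ _⟩⟩
    · exact hmode (exists_query_or_colon D hd F b)
  · exact ((D.noBroadcast hB).false b).elim

/-! ### Persistence of unaffected derivations -/

/-- There is a derivation from `P'` of a formula of the same kind and with the same label as the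
given one, whose necessary synchrons have the argument strings `X`. -/
def Persists (D : Spec d A Ch Bn Sg) : Formula d A Ch Bn Sg → Proc d A Ch Bn Sg →
    Set (List (Arg A Ch Bn Sg)) → Prop
  | .trans _ ℓ _, P', X => ∃ Q', ∃ χ : Der D (.trans P' ℓ Q'), χ.necessaryArgs = X
  | .emits _ s, P', X => ∃ χ : Der D (.emits P' s), χ.necessaryArgs = X

theorem Der.persists {φ : Formula d A Ch Bn Sg} (χ : Der D φ) :
    Persists D φ φ.source ((fun l => strip l ∅) '' χ.necessaryArgs) := by
  cases φ with
  | trans P ℓ Q => exact ⟨Q, χ, (strip_image_empty _).symm⟩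
  | emits P s => exact ⟨χ, (strip_image_empty _).symm⟩

/-- The labels other than `b?` and `b:`. -/
def Label.IsSBullet (ℓ : Label Ch Bn Sg) : Prop :=
  ∀ b : Bn, ℓ ≠ .act (.recv b) ∧ ℓ ≠ .discard b

theorem Compl.isSBullet {c c' : Label Ch Bn Sg} (h : Compl c c') : c.IsSBullet ∧ c'.IsSBullet := by
  cases h <;> simp [Label.IsSBullet]

theorem isSBullet_emission (s : Sg) : (Label.emission s : Label Ch Bn Sg).IsSBullet := by
  simp [Label.IsSBullet]

theorem isSBullet_sig (s : Sg) : (Label.act (.sig s) : Label Ch Bn Sg).IsSBullet := by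
  simp [Label.IsSBullet]

theorem isSBullet_of_onLabel {f : Relabelling Ch Bn Sg} {ℓ : Label Ch Bn Sg}
    (h : (f.onLabel ℓ).IsSBullet) : ℓ.IsSBullet := by
  intro b
  have := h (f.bn b)
  constructor <;> rintro rfl <;> simp [Relabelling.onLabel, Relabelling.onAct] at this

theorem Mode.isSBullet_label {m : Mode} {b : Bn} (h : (m.label b : Label Ch Bn Sg).IsSBullet) :
    m = .bang := by
  have := h b
  cases m <;> simp_all [Mode.label]

theorem necessaryArgs_of_pair {X Y : Set (Synchron d A Ch Bn Sg)} {ℓ c c' : Label Ch Bn Sg}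
    (hℓ : ¬ ℓ.IsBroadcast) (hc : ¬ c.IsBroadcast) (hc' : ¬ c'.IsBroadcast) :
    leafArgs (Leaf.IsNecessary ℓ) (Arg.parL.app X ∪ Arg.parR.app Y) =
      List.cons .parL '' leafArgs (Leaf.IsNecessary c) X ∪
        List.cons .parR '' leafArgs (Leaf.IsNecessary c') Y := by
  rw [leafArgs_union, leafArgs_app, leafArgs_app, isNecessary_of_not hℓ, isNecessary_of_not hc,
    isNecessary_of_not hc']

/-- Induction on the derivation. Under a dynamic operator the mover is either idle or, by
divergence, moved inside the same argument; the operator then disappears both from the process and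
from the strings. Under a static operator the move splits into moves of the arguments, and the rule
is applied again to the residuals. For a broadcast the receiving side may have changed arbitrarily,
since only the sender is necessary: the sender's residual is rebuilt, and `exists_par_broadcast`
completes it with whatever the other side has become. -/
theorem Der.persists_of_allDiverge {φ : Formula d A Ch Bn Sg} (χ : Der D φ) :
    φ.label.IsSBullet → ∀ {P' : Proc d A Ch Bn Sg} {V : Set (List (Arg A Ch Bn Sg))},
      Moves D φ.source P' V → AllDiverge χ.necessaryArgs V →
        Persists D φ P' ((fun l => strip l V) '' χ.necessaryArgs) := by
  have htau : ¬ (Label.act .tau : Label Ch Bn Sg).IsBroadcast := by simp [Label.IsBroadcast]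
  have hsig : ∀ s : Sg, ¬ (Label.act (.sig s) : Label Ch Bn Sg).IsBroadcast := by
    simp [Label.IsBroadcast]
  have hemi : ∀ s : Sg, ¬ (Label.emission s : Label Ch Bn Sg).IsBroadcast := by
    simp [Label.IsBroadcast]
  induction χ with
  | act α P =>
    intro _ P' V hM hD
    rcases hM.pre with ⟨rfl, rfl⟩ | rfl
    · exact (Der.act α P).persists
    -- The prefix itself has been executed; its active string is empty, and nothing diverges from
    -- the empty string.
    · obtain ⟨l, hl⟩ := necessaryArgs_nonempty (Der.act (D := D) α P)
      exact absurd (hD l hl [] rfl) (not_diverge_nil_right l)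
  | sumL χ Q ih | emitSumL χ Q ih | emtSumL χ Q ih =>
    intro hℓ P' V hM hD
    rcases hM.sum with ⟨rfl, rfl⟩ | ⟨W, hW, hM', rfl⟩ | ⟨W, hW, hM', rfl⟩
    · apply Der.persists
    · simp only [Der.necessaryArgs, Der.synchrons, leafArgs_app] at hD ⊢
      exact hD.of_cons_dynamic (by simp [Arg.isStatic]) hW (C := Persists D _ P') (ih hℓ hM')
    · simp only [Der.necessaryArgs, Der.synchrons, leafArgs_app] at hD
      exact (hD.elim (by simp [Arg.isPar]) (by simp) (necessaryArgs_nonempty χ) hW).elim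
  | sumR Q χ ih | emitSumR Q χ ih | emtSumR Q χ ih =>
    intro hℓ P' V hM hD
    rcases hM.sum with ⟨rfl, rfl⟩ | ⟨W, hW, hM', rfl⟩ | ⟨W, hW, hM', rfl⟩
    · apply Der.persists
    · simp only [Der.necessaryArgs, Der.synchrons, leafArgs_app] at hD
      exact (hD.elim (by simp [Arg.isPar]) (by simp) (necessaryArgs_nonempty χ) hW).elim
    · simp only [Der.necessaryArgs, Der.synchrons, leafArgs_app] at hD ⊢
      exact hD.of_cons_dynamic (by simp [Arg.isStatic]) hW (C := Persists D _ P') (ih hℓ hM')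
  | sigAct χ r ih | emitSig χ r ih | emtSig χ r ih =>
    intro hℓ P' V hM hD
    rcases hM.signal with ⟨rfl, rfl⟩ | ⟨W, hW, hM', rfl⟩
    · apply Der.persists
    · simp only [Der.necessaryArgs, Der.synchrons, leafArgs_app] at hD ⊢
      exact hD.of_cons_dynamic (by simp [Arg.isStatic]) hW (C := Persists D _ P') (ih hℓ hM')
  | agent a χ ih | emitAgent a χ ih | emtAgent a χ ih =>
    intro hℓ P' V hM hD
    rcases hM.agent with ⟨rfl, rfl⟩ | ⟨W, hW, hM', rfl⟩
    · apply Der.persists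
    · simp only [Der.necessaryArgs, Der.synchrons, leafArgs_app] at hD ⊢
      exact hD.of_cons_dynamic (by simp [Arg.isStatic]) hW (C := Persists D _ P') (ih hℓ hM')
  | emit hd P s | emt hd P s =>
    intro _ P' V hM hD
    rcases hM.signal with ⟨rfl, rfl⟩ | ⟨W, ⟨m, hm⟩, hM', rfl⟩
    · apply Der.persists
    · exact absurd (hD [] ⟨_, fun h => absurd h (hemi s), rfl⟩ _ ⟨m, hm, rfl⟩)
        (not_diverge_nil_left _)
  | parL χ Q hη ih =>
    intro hℓ P' V hM hD
    obtain ⟨P₁, Q₁, W₁, W₂, rfl, hM₁, hM₂, rfl⟩ := hM.par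
    simp only [Der.necessaryArgs, Der.synchrons, leafArgs_app] at hD
    obtain ⟨Q', χ', h⟩ := ih hℓ hM₁ (hD.of_cons subset_rfl Set.subset_union_left)
    refine ⟨_, .parL χ' Q₁ hη, ?_⟩
    simp only [Der.necessaryArgs, Der.synchrons, leafArgs_app, strip_image_parL]
    exact congrArg _ h
  | parR Q χ hη ih =>
    intro hℓ P' V hM hD
    obtain ⟨P₁, Q₁, W₁, W₂, rfl, hM₁, hM₂, rfl⟩ := hM.par
    simp only [Der.necessaryArgs, Der.synchrons, leafArgs_app] at hD
    obtain ⟨Q', χ', h⟩ := ih hℓ hM₂ (hD.of_cons subset_rfl Set.subset_union_right)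
    refine ⟨_, .parR P₁ χ' hη, ?_⟩
    simp only [Der.necessaryArgs, Der.synchrons, leafArgs_app, strip_image_parR]
    exact congrArg _ h
  | emitParL χ Q ih =>
    intro hℓ P' V hM hD
    obtain ⟨P₁, Q₁, W₁, W₂, rfl, hM₁, hM₂, rfl⟩ := hM.par
    simp only [Der.necessaryArgs, Der.synchrons, leafArgs_app] at hD
    obtain ⟨χ', h⟩ := ih hℓ hM₁ (hD.of_cons subset_rfl Set.subset_union_left)
    refine ⟨.emitParL χ' Q₁, ?_⟩
    simp only [Der.necessaryArgs, Der.synchrons, leafArgs_app, strip_image_parL]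
    exact congrArg _ h
  | emitParR Q χ ih =>
    intro hℓ P' V hM hD
    obtain ⟨P₁, Q₁, W₁, W₂, rfl, hM₁, hM₂, rfl⟩ := hM.par
    simp only [Der.necessaryArgs, Der.synchrons, leafArgs_app] at hD
    obtain ⟨χ', h⟩ := ih hℓ hM₂ (hD.of_cons subset_rfl Set.subset_union_right)
    refine ⟨.emitParR P₁ χ', ?_⟩
    simp only [Der.necessaryArgs, Der.synchrons, leafArgs_app, strip_image_parR]
    exact congrArg _ h
  | res χ L hη ih =>
    intro hℓ P' V hM hD
    obtain ⟨P₁, W, rfl, hM₁, rfl⟩ := hM.res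
    simp only [Der.necessaryArgs, Der.synchrons, leafArgs_app] at hD
    obtain ⟨Q', χ', h⟩ := ih hℓ hM₁ (hD.of_cons subset_rfl subset_rfl)
    refine ⟨_, .res χ' L hη, ?_⟩
    simp only [Der.necessaryArgs, Der.synchrons, leafArgs_app]
    rw [strip_image_cons_of_isStatic rfl]
    exact congrArg _ h
  | emitRes χ L hη ih =>
    intro hℓ P' V hM hD
    obtain ⟨P₁, W, rfl, hM₁, rfl⟩ := hM.res
    simp only [Der.necessaryArgs, Der.synchrons, leafArgs_app] at hD
    obtain ⟨χ', h⟩ := ih hℓ hM₁ (hD.of_cons subset_rfl subset_rfl)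
    refine ⟨.emitRes χ' L hη, ?_⟩
    simp only [Der.necessaryArgs, Der.synchrons, leafArgs_app]
    rw [strip_image_cons_of_isStatic rfl]
    exact congrArg _ h
  | rel χ f hf hℓ' ih =>
    subst hℓ'
    intro hℓ P' V hM hD
    obtain ⟨P₁, W, rfl, hM₁, rfl⟩ := hM.rel
    simp only [Der.necessaryArgs, Der.synchrons, leafArgs_app, Formula.label,
      isNecessary_onLabel] at hD
    obtain ⟨Q', χ', h⟩ := ih (isSBullet_of_onLabel hℓ) hM₁ (hD.of_cons subset_rfl subset_rfl)
    refine ⟨_, .rel χ' f hf rfl, ?_⟩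
    simp only [Der.necessaryArgs, Der.synchrons, leafArgs_app, Formula.label, isNecessary_onLabel]
    rw [strip_image_cons_of_isStatic rfl]
    exact congrArg _ h
  | @emitRel P s s' χ f hf hs ih =>
    subst hs
    intro hℓ P' V hM hD
    obtain ⟨P₁, W, rfl, hM₁, rfl⟩ := hM.rel
    have e : Leaf.IsNecessary (d := d) (A := A) (Label.emission (f.sg s) : Label Ch Bn Sg) =
        Leaf.IsNecessary (.emission s) := isNecessary_onLabel f (.emission s)
    simp only [Der.necessaryArgs, Der.synchrons, leafArgs_app, Formula.label, e] at hD
    obtain ⟨χ', h⟩ := ih (isSBullet_emission s) hM₁ (hD.of_cons subset_rfl subset_rfl)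
    refine ⟨.emitRel χ' f hf rfl, ?_⟩
    simp only [Der.necessaryArgs, Der.synchrons, leafArgs_app, Formula.label, e]
    rw [strip_image_cons_of_isStatic rfl]
    exact congrArg _ h
  | comm χ ζ hc ih₁ ih₂ =>
    intro hℓ P' V hM hD
    obtain ⟨P₁, Q₁, W₁, W₂, rfl, hM₁, hM₂, rfl⟩ := hM.par
    obtain ⟨hb₁, hb₂⟩ := hc.not_isBroadcast
    simp only [Der.necessaryArgs, Der.synchrons, Formula.label,
      necessaryArgs_of_pair htau hb₁ hb₂] at hD
    obtain ⟨P'', χ', h₁⟩ := ih₁ hc.isSBullet.1 hM₁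
      (hD.of_cons Set.subset_union_left Set.subset_union_left)
    obtain ⟨Q'', ζ', h₂⟩ := ih₂ hc.isSBullet.2 hM₂
      (hD.of_cons Set.subset_union_right Set.subset_union_right)
    refine ⟨_, .comm χ' ζ' hc, ?_⟩
    simp only [Der.necessaryArgs, Der.synchrons, Formula.label,
      necessaryArgs_of_pair htau hb₁ hb₂, Set.image_union, strip_image_parL, strip_image_parR]
    exact congrArg₂ _ (congrArg _ h₁) (congrArg _ h₂)
  | @readR P s Q Q' ξ χ ih₁ ih₂ =>
    intro hℓ P' V hM hD
    obtain ⟨P₁, Q₁, W₁, W₂, rfl, hM₁, hM₂, rfl⟩ := hM.par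
    simp only [Der.necessaryArgs, Der.synchrons, Formula.label,
      necessaryArgs_of_pair htau (hemi s) (hsig s)] at hD
    obtain ⟨ξ', h₁⟩ := ih₁ (isSBullet_emission s) hM₁
      (hD.of_cons Set.subset_union_left Set.subset_union_left)
    obtain ⟨Q'', χ', h₂⟩ := ih₂ (isSBullet_sig s) hM₂
      (hD.of_cons Set.subset_union_right Set.subset_union_right)
    refine ⟨_, .readR ξ' χ', ?_⟩
    simp only [Der.necessaryArgs, Der.synchrons, Formula.label,
      necessaryArgs_of_pair htau (hemi s) (hsig s), Set.image_union, strip_image_parL,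
      strip_image_parR]
    exact congrArg₂ _ (congrArg _ h₁) (congrArg _ h₂)
  | @readL P s P'' Q χ ξ ih₁ ih₂ =>
    intro hℓ P' V hM hD
    obtain ⟨P₁, Q₁, W₁, W₂, rfl, hM₁, hM₂, rfl⟩ := hM.par
    simp only [Der.necessaryArgs, Der.synchrons, Formula.label,
      necessaryArgs_of_pair htau (hsig s) (hemi s)] at hD
    obtain ⟨Q'', χ', h₁⟩ := ih₁ (isSBullet_sig s) hM₁
      (hD.of_cons Set.subset_union_left Set.subset_union_left)
    obtain ⟨ξ', h₂⟩ := ih₂ (isSBullet_emission s) hM₂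
      (hD.of_cons Set.subset_union_right Set.subset_union_right)
    refine ⟨_, .readL χ' ξ', ?_⟩
    simp only [Der.necessaryArgs, Der.synchrons, Formula.label,
      necessaryArgs_of_pair htau (hsig s) (hemi s), Set.image_union, strip_image_parL,
      strip_image_parR]
    exact congrArg₂ _ (congrArg _ h₁) (congrArg _ h₂)
  | broC b m₁ m₂ m χ ζ hm hℓ' ih₁ ih₂ =>
    subst hℓ'
    intro hℓ P' V hM hD
    obtain ⟨P₁, Q₁, W₁, W₂, rfl, hM₁, hM₂, rfl⟩ := hM.par
    obtain rfl := Mode.isSBullet_label hℓ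
    rcases Mode.comp_eq_bang hm with ⟨rfl, h'⟩ | ⟨rfl, h'⟩
    · rw [show (Der.broC b .bang m₂ .bang χ ζ hm rfl).necessaryArgs = _ from
        necessaryArgs_of_broadcast_left χ ζ h'] at hD ⊢
      obtain ⟨P'', χ', h⟩ := ih₁ hℓ hM₁ (hD.of_cons subset_rfl Set.subset_union_left)
      obtain ⟨F', χ'', h''⟩ := (exists_par_broadcast (F := Q₁) χ').1
      refine ⟨_, χ'', h''.trans ?_⟩
      rw [strip_image_parL]
      exact congrArg _ h
    · rw [show (Der.broC b m₁ .bang .bang χ ζ hm rfl).necessaryArgs = _ from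
        necessaryArgs_of_broadcast_right ζ χ h'] at hD ⊢
      obtain ⟨P'', χ', h⟩ := ih₂ hℓ hM₂ (hD.of_cons subset_rfl Set.subset_union_right)
      obtain ⟨F', χ'', h''⟩ := (exists_par_broadcast (F := P₁) χ').2
      refine ⟨_, χ'', h''.trans ?_⟩
      rw [strip_image_parR]
      exact congrArg _ h
  | broL hd b m χ F hF hℓ' ih =>
    subst hℓ'
    intro hℓ P' V hM hD
    obtain ⟨P₁, Q₁, W₁, W₂, rfl, hM₁, hM₂, rfl⟩ := hM.par
    obtain rfl := Mode.isSBullet_label hℓ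
    simp only [Der.necessaryArgs, Der.synchrons, leafArgs_app] at hD ⊢
    obtain ⟨P'', χ', h⟩ := ih hℓ hM₁ (hD.of_cons subset_rfl Set.subset_union_left)
    obtain ⟨F', χ'', h''⟩ := (exists_par_broadcast (F := Q₁) χ').1
    refine ⟨_, χ'', h''.trans ?_⟩
    rw [strip_image_parL]
    exact congrArg _ h
  | broR hd b m F hF χ hℓ' ih =>
    subst hℓ'
    intro hℓ P' V hM hD
    obtain ⟨P₁, Q₁, W₁, W₂, rfl, hM₁, hM₂, rfl⟩ := hM.par
    obtain rfl := Mode.isSBullet_label hℓ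
    simp only [Der.necessaryArgs, Der.synchrons, leafArgs_app] at hD ⊢
    obtain ⟨P'', χ', h⟩ := ih hℓ hM₂ (hD.of_cons subset_rfl Set.subset_union_right)
    obtain ⟨F', χ'', h''⟩ := (exists_par_broadcast (F := P₁) χ').2
    refine ⟨_, χ'', h''.trans ?_⟩
    rw [strip_image_parR]
    exact congrArg _ h
  | disNil hd b => exact fun h => absurd rfl (h b).2
  | disPre hd b α P hα => exact fun h => absurd rfl (h b).2
  | @disSum _ _ _ _ b χ ζ => exact fun h => absurd rfl (h b).2
  | @disAgent b _ a χ => exact fun h => absurd rfl (h b).2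

/-! ### Synchrons of the same process -/

/-- `ArgPath D P l e`: the arguments `l` lead from the root of `P` (with agent identifiers unfolded)
to a prefix or a signal emission with leaf `e`. -/
inductive ArgPath (D : Spec d A Ch Bn Sg) :
    Proc d A Ch Bn Sg → List (Arg A Ch Bn Sg) → Leaf d A Ch Bn Sg → Prop
  | pre (α P) : ArgPath D (.pre α P) [] (.act α P)
  | emit (P s) : ArgPath D (.signal P s) [] (.emit P s)
  | sumL {P l e} (Q) : ArgPath D P l e → ArgPath D (.sum P Q) (.sumL :: l) e
  | sumR {Q l e} (P) : ArgPath D Q l e → ArgPath D (.sum P Q) (.sumR :: l) e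
  | parL {P l e} (Q) : ArgPath D P l e → ArgPath D (.par P Q) (.parL :: l) e
  | parR {Q l e} (P) : ArgPath D Q l e → ArgPath D (.par P Q) (.parR :: l) e
  | res {P l e} (L) : ArgPath D P l e → ArgPath D (.res P L) (.res L :: l) e
  | rel {P l e} (f hf) : ArgPath D P l e → ArgPath D (.rel P f hf) (.rel f :: l) e
  | agent {l e} (a) : ArgPath D (D.defn a) l e → ArgPath D (.agent a) (.agent a :: l) e
  | signal {P l e} (r) : ArgPath D P l e → ArgPath D (.signal P r) (.signal r :: l) e

/-- Placing synchrons in the unfolded syntax tree of the source makes those of different derivations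
comparable. Discards are left out because their leaves do not record a position of this tree. -/
theorem argPath_of_mem_synchrons {φ : Formula d A Ch Bn Sg} (χ : Der D φ) :
    ∀ s ∈ χ.synchrons, (∀ b, s.leaf ≠ .disc b) → ArgPath D φ.source s.args s.leaf := by
  have happ : ∀ {ι : Arg A Ch Bn Sg} {X : Set (Synchron d A Ch Bn Sg)} {P P' : Proc d A Ch Bn Sg},
      (∀ l e, ArgPath D P l e → ArgPath D P' (ι :: l) e) →
      (∀ s ∈ X, (∀ b, s.leaf ≠ .disc b) → ArgPath D P s.args s.leaf) →
      ∀ s ∈ ι.app X, (∀ b, s.leaf ≠ .disc b) → ArgPath D P' s.args s.leaf := by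
    rintro ι X P P' hι hX _ ⟨s, hs, rfl⟩ hb
    exact hι _ _ (hX s hs hb)
  induction χ with
  | act α P => rintro s rfl -; exact .pre α P
  | sumL χ Q ih | emitSumL χ Q ih | emtSumL χ Q ih => exact happ (fun _ _ => .sumL Q) ih
  | sumR P χ ih | emitSumR P χ ih | emtSumR P χ ih => exact happ (fun _ _ => .sumR P) ih
  | parL χ Q hη ih => exact happ (fun _ _ => .parL Q) ih
  | parR P χ hη ih => exact happ (fun _ _ => .parR P) ih
  | emitParL χ Q ih => exact happ (fun _ _ => .parL Q) ih
  | emitParR P χ ih => exact happ (fun _ _ => .parR P) ih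
  | comm χ ζ hc ih₁ ih₂ =>
    rintro s (hs | hs)
    · exact happ (fun _ _ => .parL _) ih₁ s hs
    · exact happ (fun _ _ => .parR _) ih₂ s hs
  | readL χ ξ ih₁ ih₂ | readR ξ χ ih₁ ih₂ =>
    rintro s (hs | hs)
    · exact happ (fun _ _ => .parL _) ih₁ s hs
    · exact happ (fun _ _ => .parR _) ih₂ s hs
  | broC b m₁ m₂ m χ ζ hm hℓ ih₁ ih₂ =>
    rintro s (hs | hs)
    · exact happ (fun _ _ => .parL _) ih₁ s hs
    · exact happ (fun _ _ => .parR _) ih₂ s hs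
  | broL hd b m χ F hF hℓ ih => exact happ (fun _ _ => .parL F) ih
  | broR hd b m E hE χ hℓ ih => exact happ (fun _ _ => .parR E) ih
  | res χ L hℓ ih => exact happ (fun _ _ => .res L) ih
  | emitRes χ L hs ih => exact happ (fun _ _ => .res L) ih
  | rel χ f hf hℓ ih => exact happ (fun _ _ => .rel f hf) ih
  | emitRel χ f hf hs ih => exact happ (fun _ _ => .rel f hf) ih
  | agent a χ ih | emitAgent a χ ih | emtAgent a χ ih | disAgent a χ ih =>
    exact happ (fun _ _ => .agent a) ih
  | sigAct χ r ih | emitSig χ r ih | emtSig χ r ih => exact happ (fun _ _ => .signal r) ih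
  | disNil hd b => rintro s rfl hb; exact absurd rfl (hb b)
  | disPre hd b α P hα => rintro s rfl hb; exact absurd rfl (hb b)
  | disSum χ ζ ih₁ ih₂ =>
    rintro s (hs | hs)
    · exact happ (fun _ _ => .sumL _) ih₁ s hs
    · exact happ (fun _ _ => .sumR _) ih₂ s hs
  | emit hd P s => rintro s rfl -; exact .emit _ _
  | emt hd P s => rintro s rfl -; exact .emit _ _

/-- The ways in which the argument strings of two synchrons of the same process, the second of them
active, relate to each other. -/
def Compatible (l m : List (Arg A Ch Bn Sg)) : Prop :=
  m = l ∨ (∃ a x, ¬ a.isStatic ∧ m = l ++ a :: x) ∨ Diverge l m ∨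
    ∃ ρ a b x y, ¬ a.isStatic ∧ ¬ b.isStatic ∧ a ≠ b ∧ l = ρ ++ a :: x ∧ m = ρ ++ b :: y

theorem Compatible.cons {l m : List (Arg A Ch Bn Sg)} (h : Compatible l m) (a : Arg A Ch Bn Sg) :
    Compatible (a :: l) (a :: m) := by
  rcases h with rfl | ⟨b, x, hb, rfl⟩ | h | ⟨ρ, b, c, x, y, hb, hc, hbc, rfl, rfl⟩
  · exact .inl rfl
  · exact .inr (.inl ⟨b, x, hb, rfl⟩)
  · exact .inr (.inr (.inl (diverge_cons_cons.2 h)))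
  · exact .inr (.inr (.inr ⟨a :: ρ, b, c, x, y, hb, hc, hbc, rfl, rfl⟩))

/-- Two paths in one tree separate at a parallel composition or at a choice, unless one is a prefix
of the other. A prefix `α.P` ends both paths, so a proper extension arises only below a signal
emission. As `m` ends in an action, the longer path is then `m`. -/
theorem ArgPath.compatible {P : Proc d A Ch Bn Sg} {l m : List (Arg A Ch Bn Sg)}
    {e e' : Leaf d A Ch Bn Sg} (h : ArgPath D P l e) (h' : ArgPath D P m e')
    (he' : e'.IsActive) : Compatible l m := by
  obtain ⟨α, R, rfl⟩ := he'
  induction h generalizing m with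
  | pre β P => cases h'; exact .inl rfl
  | emit P s => cases h' with
    | signal _ h' => exact .inr (.inl ⟨.signal s, _, by simp [Arg.isStatic], rfl⟩)
  | sumL Q h ih => cases h' with
    | sumL _ h' => exact (ih h').cons _
    | sumR _ h' => exact .inr (.inr (.inr ⟨[], .sumL, .sumR, _, _, by simp [Arg.isStatic],
        by simp [Arg.isStatic], by simp, rfl, rfl⟩))
  | sumR P h ih => cases h' with
    | sumR _ h' => exact (ih h').cons _
    | sumL _ h' => exact .inr (.inr (.inr ⟨[], .sumR, .sumL, _, _, by simp [Arg.isStatic],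
        by simp [Arg.isStatic], by simp, rfl, rfl⟩))
  | parL Q h ih => cases h' with
    | parL _ h' => exact (ih h').cons _
    | parR _ h' => exact .inr (.inr (.inl ⟨[], .parL, .parR, _, _, .inl ⟨rfl, rfl⟩, rfl, rfl⟩))
  | parR P h ih => cases h' with
    | parR _ h' => exact (ih h').cons _
    | parL _ h' => exact .inr (.inr (.inl ⟨[], .parR, .parL, _, _, .inr ⟨rfl, rfl⟩, rfl, rfl⟩))
  | res L h ih => cases h' with
    | res _ h' => exact (ih h').cons _
  | rel f hf h ih => cases h' with
    | rel _ _ h' => exact (ih h').cons _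
  | agent a h ih => cases h' with
    | agent _ h' => exact (ih h').cons _
  | signal r h ih => cases h' with
    | signal _ h' => exact (ih h').cons _

/-- If one string extends the other, so do their static parts, which would have to diverge;
different branches of a choice are excluded by `not_argsConc_of_dynamic`. -/
theorem Compatible.diverge_of_argsConc {l m : List (Arg A Ch Bn Sg)} (h : Compatible l m)
    (hc : ArgsConc l m) : Diverge l m := by
  rcases h with rfl | ⟨a, x, -, rfl⟩ | h | ⟨ρ, a, b, x, y, ha, hb, hab, rfl, rfl⟩
  · exact absurd rfl hc.diverge_staticPart.ne
  · have := hc.diverge_staticPart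
    rw [staticPart_append] at this
    exact absurd this (not_diverge_append _ _)
  · exact h
  · exact absurd hc (not_argsConc_of_dynamic ha hb hab)

/-- In all other cases the strings agree up to the first dynamic argument of either, so their static
components coincide. -/
theorem Compatible.staticDiverge_of_ne {l m : List (Arg A Ch Bn Sg)} (h : Compatible l m)
    (hne : staticPrefix l ≠ staticPrefix m) : StaticDiverge l m := by
  rcases h with rfl | ⟨a, x, ha, rfl⟩ | h | ⟨ρ, a, b, x, y, ha, hb, -, rfl, rfl⟩
  · exact absurd rfl hne
  · exact absurd (staticPrefix_append_dynamic ha _ _).symm hne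
  · exact staticDiverge_of_diverge h hne
  · rw [staticPrefix_append_dynamic ha, staticPrefix_append_dynamic hb] at hne
    exact absurd rfl hne

theorem compatible_of_source_eq {φ ψ : Formula d A Ch Bn Sg} (χ : Der D φ) (ζ : Der D ψ)
    (hs : φ.source = ψ.source) (hφ : φ.label.IsSBullet) {l m : List (Arg A Ch Bn Sg)}
    (hl : l ∈ χ.necessaryArgs) (hm : m ∈ ζ.activeArgs) : Compatible l m := by
  obtain ⟨e, he, hl⟩ := hl
  obtain ⟨e', he', hm⟩ := hm
  have h₁ : ArgPath D φ.source l e := by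
    refine argPath_of_mem_synchrons χ _ hl ?_
    rintro b rfl
    -- A discard leaf forces a label with a mode, hence `b!`; but then a necessary synchron has a
    -- broadcast leaf.
    obtain ⟨M, b', hM⟩ := (fits_of_mem_synchrons χ _ hl).2 ⟨b, rfl⟩
    rw [hM] at hφ he
    obtain rfl := Mode.isSBullet_label hφ
    obtain ⟨_, _, h⟩ := he ⟨b', rfl⟩
    cases h
  have h₂ : ArgPath D ψ.source m e' := by
    refine argPath_of_mem_synchrons ζ _ hm ?_
    rintro b rfl
    obtain ⟨_, _, h⟩ := he'
    cases h
  exact h₁.compatible (hs ▸ h₂) he'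

/-! ### The concurrency relations in terms of argument strings -/

theorem FormulaDeriv.necessarySyn_args (χ : FormulaDeriv D) :
    Synchron.args '' χ.necessarySyn = χ.der.necessaryArgs := by
  ext l
  constructor
  · rintro ⟨s, ⟨hs, hn⟩, rfl⟩
    exact ⟨s.leaf, hn, hs⟩
  · rintro ⟨e, he, hs⟩
    exact ⟨⟨l, e⟩, ⟨hs, he⟩, rfl⟩

theorem FormulaDeriv.activeSyn_args (χ : FormulaDeriv D) :
    Synchron.args '' χ.activeSyn = χ.der.activeArgs := by
  ext l
  constructor
  · rintro ⟨s, ⟨hs, hn⟩, rfl⟩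
    exact ⟨s.leaf, hn, hs⟩
  · rintro ⟨e, he, hs⟩
    exact ⟨⟨l, e⟩, ⟨hs, he⟩, rfl⟩

theorem Synchron.succ_iff {s s' : Synchron d A Ch Bn Sg} :
    s.Succ s' ↔ ArgsSucc s.args s'.args ∧ s'.leaf = s.leaf := by
  constructor
  · rintro (rfl | ⟨σ, p, s₂, hp, rfl, rfl⟩)
    · exact ⟨.inl rfl, rfl⟩
    · exact ⟨.inr ⟨σ, p, s₂.args, hp, by simp [under], by simp [under]⟩, rfl⟩
  · rcases s with ⟨l, e⟩
    rcases s' with ⟨l', e'⟩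
    rintro ⟨h, rfl⟩
    rcases h with h | ⟨σ, p, x, hp, h₁, h₂⟩
    · left
      simpa using h
    · right
      refine ⟨σ, p, ⟨x, e'⟩, hp, ?_, ?_⟩
      · simpa [under] using h₁
      · simpa [under] using h₂

theorem Synchron.dirConc_iff {s t : Synchron d A Ch Bn Sg} :
    s.DirConc t ↔ Diverge s.args t.args := by
  constructor
  · rintro ⟨σ, p, q, s₂, t₂, h, rfl, rfl⟩
    exact ⟨σ, p, q, s₂.args, t₂.args, h, by simp [under], by simp [under]⟩
  · rcases s with ⟨l, e⟩
    rcases t with ⟨m, e'⟩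
    rintro ⟨σ, p, q, x, y, h, h₁, h₂⟩
    refine ⟨σ, p, q, ⟨x, e⟩, ⟨y, e'⟩, h, ?_, ?_⟩
    · simpa [under] using h₁
    · simpa [under] using h₂

theorem Synchron.conc_iff {s t : Synchron d A Ch Bn Sg} : s.Conc t ↔ ArgsConc s.args t.args := by
  constructor
  · rintro ⟨s₀, t₀, h₁, h₂, h₃⟩
    exact ⟨s₀.args, t₀.args, (succ_iff.1 h₁).1, dirConc_iff.1 h₂, (succ_iff.1 h₃).1⟩
  · rintro ⟨l, m, h₁, h₂, h₃⟩
    exact ⟨⟨l, s.leaf⟩, ⟨m, t.leaf⟩, succ_iff.2 ⟨h₁, rfl⟩, dirConc_iff.2 h₂, succ_iff.2 ⟨h₃, rfl⟩⟩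

namespace FormulaDeriv

theorem npc_eq (χ : FormulaDeriv D) : χ.npc = staticPrefix '' χ.der.necessaryArgs := by
  rw [← necessarySyn_args, Set.image_image]
  rfl

theorem afc_eq (χ : FormulaDeriv D) : χ.afc = staticPrefix '' χ.der.activeArgs := by
  rw [← activeSyn_args, Set.image_image]
  rfl

theorem npcAbs_eq (χ : FormulaDeriv D) : χ.npcAbs = List.filter Arg.isPar '' χ.npc := by
  rw [npc, Set.image_image]
  rfl

theorem afcAbs_eq (χ : FormulaDeriv D) : χ.afcAbs = List.filter Arg.isPar '' χ.afc := by
  rw [afc, Set.image_image]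
  rfl

theorem conc_iff {χ ζ : FormulaDeriv D} :
    χ.Conc ζ ↔ ∀ l ∈ χ.der.necessaryArgs, ∀ m ∈ ζ.der.activeArgs, ArgsConc l m := by
  simp only [← necessarySyn_args, ← activeSyn_args, Set.forall_mem_image, Conc, Synchron.conc_iff]

theorem concS_iff {χ ζ : FormulaDeriv D} :
    χ.ConcS ζ ↔ ∀ l ∈ χ.der.necessaryArgs, ∀ m ∈ ζ.der.activeArgs, StaticDiverge l m := by
  simp only [ConcS, npc_eq, afc_eq, Set.forall_mem_image, compConc_staticPrefix_iff]

theorem concC_iff {χ ζ : FormulaDeriv D} :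
    χ.ConcC ζ ↔ ∀ l ∈ χ.der.necessaryArgs, ∀ m ∈ ζ.der.activeArgs,
      staticPrefix l ≠ staticPrefix m := by
  rw [ConcC, npc_eq, afc_eq, ← Set.disjoint_iff_inter_eq_empty, Set.disjoint_left,
    Set.forall_mem_image]
  simp only [Set.mem_image, not_exists, not_and]
  exact ⟨fun h l hl m hm he => h hl m hm he.symm, fun h l hl m hm he => h l hl m hm he.symm⟩

theorem ConcS.conc {χ ζ : FormulaDeriv D} (h : χ.ConcS ζ) : χ.Conc ζ :=
  conc_iff.2 fun l hl m hm =>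
    ⟨l, m, .inl rfl, (concS_iff.1 h l hl m hm).diverge, .inl rfl⟩

theorem isStatic_of_mem_filter_isPar {l : List (Arg A Ch Bn Sg)} {a : Arg A Ch Bn Sg}
    (h : a ∈ l.filter Arg.isPar) : a.isStatic :=
  Arg.isStatic_of_isPar (List.mem_filter.1 h).2

/-- Deleting restrictions and relabellings keeps the parallel arguments at which the components
separate. -/
theorem ConcS.concSAbs {χ ζ : FormulaDeriv D} (h : χ.ConcS ζ) : χ.ConcSAbs ζ := by
  simp only [ConcSAbs, npcAbs_eq, afcAbs_eq, npc_eq, afc_eq, Set.forall_mem_image]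
  intro l hl m hm
  rw [compConc_iff_diverge (fun _ => isStatic_of_mem_filter_isPar)
    (fun _ => isStatic_of_mem_filter_isPar)]
  exact (concS_iff.1 h l hl m hm).staticPrefix.filter_isPar

/-- A component in both sets would have to diverge from itself. -/
theorem ConcSAbs.concCAbs {χ ζ : FormulaDeriv D} (h : χ.ConcSAbs ζ) : χ.ConcCAbs ζ := by
  refine Set.eq_empty_of_forall_notMem fun γ hγ => ?_
  have := h γ hγ.1 γ hγ.2
  rw [npcAbs_eq] at hγ
  obtain ⟨⟨δ, -, rfl⟩, -⟩ := hγ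
  rw [compConc_iff_diverge (fun _ => isStatic_of_mem_filter_isPar)
    (fun _ => isStatic_of_mem_filter_isPar)] at this
  exact this.ne rfl

theorem ConcCAbs.concC {χ ζ : FormulaDeriv D} (h : χ.ConcCAbs ζ) : χ.ConcC ζ := by
  refine Set.eq_empty_of_forall_notMem fun γ hγ => ?_
  refine Set.eq_empty_iff_forall_notMem.1 h (γ.filter Arg.isPar) ⟨?_, ?_⟩
  · rw [npcAbs_eq]
    exact ⟨γ, hγ.1, rfl⟩
  · rw [afcAbs_eq]
    exact ⟨γ, hγ.2, rfl⟩

end FormulaDeriv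

/-! ### Justness -/

/-- Justness demands a transition that is not concurrent with `t`, so it is antitone in the
relation. -/
theorem LTS.Path.IsJust.mono {T : LTS} {conc conc' : T.Tr → T.Tr → Prop} {B : Set T.Lab}
    {π : T.Path} (h : π.IsJust conc B) (hc : ∀ t u, conc' t u → conc t u) : π.IsJust conc' B := by
  intro k hk t ht hs
  obtain ⟨j, hj, hkj, hn⟩ := h k hk t ht hs
  exact ⟨j, hj, hkj, fun h' => hn (hc _ _ h')⟩

theorem Transition.exists_residual (t u : Transition D) (hs : t.source = u.source)
    (ht : t.label.IsSBullet) (h : AllDiverge t.der.necessaryArgs u.der.activeArgs) :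
    ∃ t' : Transition D, t'.source = u.target ∧ t'.label = t.label ∧
      t'.der.necessaryArgs = (fun l => strip l u.der.activeArgs) '' t.der.necessaryArgs := by
  have hM : Moves D t.source u.target u.der.activeArgs := by
    rw [hs]
    exact u.der.moves
  obtain ⟨Q, χ, hχ⟩ := t.der.persists_of_allDiverge ht hM h
  exact ⟨⟨_, _, _, χ⟩, rfl, rfl, hχ⟩

/-- With static divergence there is no shared dynamic argument to delete, so each residual has the
same necessary strings. The hypothesis on `t` can therefore be applied unchanged to the residual at
every step. -/
theorem exists_transition_of_concS (π : D.lts.Path) {k : ℕ} (hk : (k : ℕ∞) ≤ π.length)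
    (t : Transition D) (hs : t.source = π.state k hk) (ht : t.label.IsSBullet) (j : ℕ)
    (hkj : k ≤ j) :
    ∀ hj : (j : ℕ∞) ≤ π.length,
      (∀ (i : ℕ) (hi : (i : ℕ∞) < π.length), k ≤ i → i < j →
        t.toFormulaDeriv.ConcS (Transition.toFormulaDeriv (π.trans i hi))) →
      ∃ t' : Transition D, t'.source = π.state j hj ∧ t'.label = t.label ∧
        t'.der.necessaryArgs = t.der.necessaryArgs := by
  induction j, hkj using Nat.le_induction with
  | base => exact fun hj _ => ⟨t, hs, rfl, rfl⟩
  | succ j hkj ih =>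
    intro hj hc
    have hj' : (j : ℕ∞) < π.length :=
      lt_of_lt_of_le (by exact_mod_cast Nat.lt_succ_self j) hj
    obtain ⟨t₁, hs₁, hℓ₁, hn₁⟩ := ih hj'.le fun i hi hki hij => hc i hi hki (hij.trans j.lt_succ_self)
    have hS := FormulaDeriv.concS_iff.1 (hc j hj' hkj j.lt_succ_self)
    obtain ⟨t₂, hs₂, hℓ₂, hn₂⟩ := t₁.exists_residual (π.trans j hj')
      (hs₁.trans (π.source_eq j hj' hj'.le).symm) (by rwa [hℓ₁])
      (by rw [hn₁]; exact fun l hl m hm => (hS l hl m hm).diverge)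
    refine ⟨t₂, hs₂.trans (π.target_eq j hj' hj), hℓ₂.trans hℓ₁, ?_⟩
    rw [hn₂, hn₁]
    conv_rhs => rw [← Set.image_id t.der.necessaryArgs]
    exact Set.image_congr fun l hl => strip_eq_self (hS l hl)

theorem isSBullet_of_nonBlocking {B : Set (Label Ch Bn Sg)} {t : Transition D}
    (ht : t ∈ D.lts.NonBlocking B) : t.label.IsSBullet := by
  obtain ⟨⟨⟨α, hα⟩, hrec⟩, -⟩ := ht
  intro b
  constructor
  · exact fun h => hrec ⟨b, h⟩
  · intro h
    cases hα.symm.trans h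

theorem nonBlocking_of_label_eq {B : Set (Label Ch Bn Sg)} {t t' : Transition D}
    (ht : t ∈ D.lts.NonBlocking B) (h : t'.label = t.label) : t' ∈ D.lts.NonBlocking B := by
  have h' : D.lts.label t' = D.lts.label t := h
  obtain ⟨⟨h₁, h₂⟩, h₃⟩ := ht
  exact ⟨⟨Set.mem_of_eq_of_mem h' h₁, fun h => h₂ (Set.mem_of_eq_of_mem h'.symm h)⟩,
    fun h => h₃ (Set.mem_of_eq_of_mem h'.symm h)⟩

/-- As long as `t` has been statically unaffected, a copy with its necessary strings is enabled.
This copy shares its source with the next transition, so different static components mean static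
divergence, and `t` is statically unaffected by that transition as well. -/
theorem Spec.IsJust.concC_of_concS {B : Set (Label Ch Bn Sg)} {π : D.lts.Path}
    (h : D.IsJust FormulaDeriv.ConcS B π) : D.IsJust FormulaDeriv.ConcC B π := by
  intro k hk t ht hs
  by_contra! hC
  have hb := isSBullet_of_nonBlocking ht
  have hS : ∀ (j : ℕ) (hj : (j : ℕ∞) < π.length), k ≤ j →
      (Transition.toFormulaDeriv t).ConcS (Transition.toFormulaDeriv (π.trans j hj)) := by
    intro j
    induction j using Nat.strong_induction_on with
    | _ j ih =>
      intro hj hkj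
      obtain ⟨t', hs', hℓ', hn'⟩ := exists_transition_of_concS π hk t hs hb j hkj hj.le
        fun i hi hki hij => ih i hij hi hki
      refine FormulaDeriv.concS_iff.2 fun l hl m hm => ?_
      refine (compatible_of_source_eq t'.der (Transition.der (π.trans j hj))
        (hs'.trans (π.source_eq j hj hj.le).symm) (hℓ' ▸ hb) (hn' ▸ hl) hm).staticDiverge_of_ne ?_
      exact FormulaDeriv.concC_iff.1 (hC j hj hkj) l hl m hm
  obtain ⟨j, hj, hkj, hn⟩ := h k hk t ht hs
  exact hn (hS j hj hkj)

/-- The function may identify strings, which can only lower the sum over the image: each image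
string is counted once instead of once per preimage. -/
theorem finsum_length_image_lt {α : Type*} {X : Set (List α)} (hX : X.Finite)
    {f : List α → List α} (hf : ∀ l ∈ X, (f l).length ≤ l.length)
    (hlt : ∃ l ∈ X, (f l).length < l.length) :
    ∑ᶠ l ∈ f '' X, l.length < ∑ᶠ l ∈ X, l.length := by
  classical
  lift X to Finset (List α) using hX
  rw [← Finset.coe_image, finsum_mem_coe_finset, finsum_mem_coe_finset]
  refine lt_of_le_of_lt ?_ (Finset.sum_lt_sum hf hlt)
  rw [Finset.sum_comp (fun l => l.length) f]
  refine Finset.sum_le_sum fun l hl => ?_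
  rw [smul_eq_mul]
  refine Nat.le_mul_of_pos_left _ (Finset.card_pos.2 ?_)
  obtain ⟨m, hm, rfl⟩ := Finset.mem_image.1 hl
  exact ⟨m, Finset.mem_filter.2 ⟨hm, rfl⟩⟩

/-- Infinite descent on the total length of the necessary strings: `ConcS`-justness supplies a
transition that is not statically concurrent with `t`, and passing the first one deletes a dynamic
argument of the residual. -/
theorem Spec.IsJust.conc_of_concS {B : Set (Label Ch Bn Sg)} {π : D.lts.Path}
    (h : D.IsJust FormulaDeriv.ConcS B π) : D.IsJust FormulaDeriv.Conc B π := by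
  intro k hk t ht hs
  by_contra! hC
  induction hN : ∑ᶠ l ∈ (Transition.der t).necessaryArgs, l.length using Nat.strong_induction_on
    generalizing k t with
  | _ N ih =>
    subst hN
    have hb := isSBullet_of_nonBlocking ht
    classical
    have hex : ∃ j : ℕ, ∃ hj : (j : ℕ∞) < π.length, k ≤ j ∧
        ¬ (Transition.toFormulaDeriv t).ConcS (Transition.toFormulaDeriv (π.trans j hj)) :=
      h k hk t ht hs
    -- Minimality of `j` makes all earlier transitions statically concurrent with `t`, so that a
    -- copy with the same necessary strings is still enabled at `j`.
    obtain ⟨hj, hkj, hn⟩ := Nat.find_spec hex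
    have hmin := fun i => Nat.find_min hex (m := i)
    generalize Nat.find hex = j at hj hkj hn hmin
    obtain ⟨t₁, hs₁, hℓ₁, hn₁⟩ := exists_transition_of_concS π hk t hs hb j hkj hj.le
      fun i hi hki hij => by
        by_contra hS
        exact hmin i hij ⟨hi, hki, hS⟩
    have hsrc : t₁.source = Transition.source (π.trans j hj) :=
      hs₁.trans (π.source_eq j hj hj.le).symm
    have hdiv : AllDiverge (Transition.der t).necessaryArgs
        (Transition.der (π.trans j hj)).activeArgs := fun l hl m hm =>
      (compatible_of_source_eq t₁.der (Transition.der (π.trans j hj)) hsrc (hℓ₁ ▸ hb)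
        (hn₁ ▸ hl) hm).diverge_of_argsConc (FormulaDeriv.conc_iff.1 (hC j hj hkj) l hl m hm)
    obtain ⟨t₂, hs₂, hℓ₂, hn₂⟩ := t₁.exists_residual (π.trans j hj) hsrc (hℓ₁ ▸ hb)
      (by rwa [hn₁])
    rw [hn₁] at hn₂
    have hj' : ((j + 1 : ℕ) : ℕ∞) ≤ π.length := by
      push_cast
      exact Order.add_one_le_of_lt hj
    refine ih _ ?_ (j + 1) hj' t₂ (nonBlocking_of_label_eq ht (hℓ₂.trans hℓ₁))
      (hs₂.trans (π.target_eq j hj hj')) ?_ rfl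
    · rw [hn₂]
      refine finsum_length_image_lt (necessaryArgs_finite _) (fun l _ => length_strip_le _ _) ?_
      -- If no string became shorter, then all pairs would diverge statically, contrary to the
      -- choice of `j`.
      by_contra! hle
      exact hn (FormulaDeriv.concS_iff.2 fun l hl =>
        staticDiverge_of_length_strip (hdiv l hl) (hle l hl))
    · intro i hi hji
      refine FormulaDeriv.conc_iff.2 fun l' hl' m hm => ?_
      rw [show (Transition.toFormulaDeriv t₂).der.necessaryArgs = _ from hn₂] at hl'
      obtain ⟨l, hl, rfl⟩ := hl'
      -- A stripped string is a successor of the original one, and concurrency is inherited by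
      -- successors. The definition of synchron concurrency through predecessors is what makes the
      -- descent repeatable.
      exact (FormulaDeriv.conc_iff.1 (hC i hi (hkj.trans (j.le_succ.trans hji))) l hl m hm).of_succ
        (argsSucc_strip (hdiv l hl))

/-- In `τ.0|τ.0 + 0` the two transitions are concurrent, but not statically concurrent. -/
theorem exists_conc_and_not_concS (D : Spec d A Ch Bn Sg) : ∃ t u : Transition D,
    t ∈ D.lts.TrBullet ∧ t.toFormulaDeriv.Conc u.toFormulaDeriv ∧
      ¬ t.toFormulaDeriv.ConcS u.toFormulaDeriv := by
  have hη : (Label.act .tau : Label Ch Bn Sg).NonBroadcast := by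
    intro m b
    cases m <;> simp [Mode.label]
  let P : Proc d A Ch Bn Sg := .pre .tau .nil
  let t : Transition D := ⟨_, _, _, .sumL (.parL (.act .tau .nil) P hη) .nil⟩
  let u : Transition D := ⟨_, _, _, .sumL (.parR P (.act .tau .nil) hη) .nil⟩
  have hnec : t.der.necessaryArgs = {[.sumL, .parL]} := by
    simp [t, Der.necessaryArgs, Der.synchrons, leafArgs_app, leafArgs_singleton,
      Leaf.IsNecessary, Label.IsBroadcast, Formula.label]
  have hact : u.der.activeArgs = {[.sumL, .parR]} := by
    simp [u, Der.activeArgs, Der.synchrons, leafArgs_app, leafArgs_singleton, Leaf.IsActive]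
  refine ⟨t, u, ⟨⟨.tau, rfl⟩, ?_⟩, ?_, ?_⟩
  · rintro ⟨b, hb⟩
    cases hb
  · refine FormulaDeriv.conc_iff.2 fun l hl m hm => ?_
    rw [show t.toFormulaDeriv.der.necessaryArgs = _ from hnec] at hl
    rw [show u.toFormulaDeriv.der.activeArgs = _ from hact] at hm
    obtain rfl := hl
    obtain rfl := hm
    -- The strings separate at the parallel composition, but only behind the shared dynamic argument
    -- `+_L`; this is what defeats static concurrency below.
    exact ⟨_, _, .inl rfl, ⟨[.sumL], .parL, .parR, [], [], .inl ⟨rfl, rfl⟩, rfl, rfl⟩, .inl rfl⟩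
  · intro h
    have := FormulaDeriv.concS_iff.1 h [.sumL, .parL] (hnec.ge rfl) [.sumL, .parR] (hact.ge rfl)
    exact absurd (staticDiverge_cons_cons.1 this).1 (by simp [Arg.isStatic])

end Derivations

end Justness

/-! ### Equivalence of the five notions of justness, and strictness. -/

theorem mainTheorem5 {d : Dialect} {A : Type*} {Ch : Type*} {Bn : Type*} {Sg : Type*}
    (D : Spec d A Ch Bn Sg) :
    (∀ B : Set (Label Ch Bn Sg), D.lts.Rec ⊆ B → B ⊆ D.lts.Act → ∀ π : D.lts.Path,
      (D.IsJust FormulaDeriv.Conc B π ↔ D.IsJust FormulaDeriv.ConcS B π) ∧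
      (D.IsJust FormulaDeriv.ConcC B π ↔ D.IsJust FormulaDeriv.ConcS B π) ∧
      (D.IsJust FormulaDeriv.ConcSAbs B π ↔ D.IsJust FormulaDeriv.ConcS B π) ∧
      (D.IsJust FormulaDeriv.ConcCAbs B π ↔ D.IsJust FormulaDeriv.ConcS B π)) ∧
    (∀ (χ : FormulaDeriv D) (ζ : Transition D), χ.InTrSBullet →
      χ.ConcS ζ.toFormulaDeriv → χ.Conc ζ.toFormulaDeriv) ∧
    (∃ t u : Transition D, t ∈ D.lts.TrBullet ∧
      t.toFormulaDeriv.Conc u.toFormulaDeriv ∧ ¬ t.toFormulaDeriv.ConcS u.toFormulaDeriv) := by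
  refine ⟨fun B _ _ π => ⟨⟨fun h => h.mono fun _ _ => FormulaDeriv.ConcS.conc,
    Spec.IsJust.conc_of_concS⟩, ⟨fun h => h.mono fun _ _ hS => hS.concSAbs.concCAbs.concC,
    Spec.IsJust.concC_of_concS⟩, ⟨fun h => h.mono fun _ _ => FormulaDeriv.ConcS.concSAbs,
    fun h => (Spec.IsJust.concC_of_concS h).mono fun _ _ hS => hS.concCAbs.concC⟩,
    ⟨fun h => h.mono fun _ _ hS => hS.concSAbs.concCAbs,
    fun h => (Spec.IsJust.concC_of_concS h).mono fun _ _ => FormulaDeriv.ConcCAbs.concC⟩⟩,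
    fun χ ζ _ h => h.conc, exists_conc_and_not_concS D⟩
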